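/- **Setting.** Fix an integer $N\ge 0$. A *categorical action of the shifted $q=0$ affine algebra $\dot{\mathcal U}_{0,N}(L\mathfrak{sl}_2)$* consists of the following data. There is a triangulated, $\mathbb C$-linear, idempotent complete 2-category $\mathcal K$ (its categories of 1-morphisms are $\mathbb C$-linear, triangulated and idempotent complete, and composition is linear and exact in each variable) with objects $\mathcal K(k,N-k)$, $0\le k\le N$. Each $\mathcal K(k,N-k)$ is itself a $\mathbb C$-linear triangulated category on which 1-morphisms act by linear exact functors and 2-morphisms by natural transformations compatible with shifts, and evaluating 1-morphisms at an object is linear and exact, compatibly with shifts and naturally in the object; set $\mathcal K(k,N-k)=0$ for $k\notin[0,N]$. There are 1-morphisms, with $\mathbf 1_k$ the identity of $\mathcal K(k,N-k)$, $$E_r\mathbf 1_k:\mathcal K(k,N-k)\to\mathcal K(k-1,N-k+1)\ (-k-1\le r\le 0),\qquad F_s\mathbf 1_k:\mathcal K(k,N-k)\to\mathcal K(k+1,N-k-1)\ (0\le s\le N-k+1),$$ and endomorphisms $(\Psi^{\pm})^{\pm1}\mathbf 1_k$, $H_{\pm1}\mathbf 1_k$ of $\mathcal K(k,N-k)$. Write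 $E=E_0$, $F=F_0$, and $(-)^L,(-)^R$ for left and right adjoints. The following hold, for all $0\le k\le N$ and all indices for which every generator involved is defined: 1. the space of 2-morphisms between any two 1-morphisms is finite dimensional; 2. $(H_1\mathbf 1_k)^L\cong \mathbf 1_kH_{-1}\cong(H_1\mathbf 1_k)^R$; 3. $(E_r\mathbf 1_k)^R\cong(\Psi^+)^{r+1}F_{N-k+2}(\Psi^+)^{-r-2}[-r-1]$, $(E_r\mathbf 1_k)^L\cong(\Psi^-)^{r+k-1}F(\Psi^-)^{-r-k}[r+k]$, $(F_s\mathbf 1_k)^R\cong(\Psi^-)^{-s+1}E_{-k-2}(\Psi^-)^{s-2}[s-1]$, $(F_s\mathbf 1_k)^L\cong(\Psi^+)^{-s+N-k-1}E(\Psi^+)^{s-N+k}[-s+N-k]$; 4. $(\Psi^\pm)^{+1}$ and $(\Psi^\pm)^{-1}$ are mutually inverse, the 1-morphisms $(\Psi^{+})^{\pm1},(\Psi^-)^{\pm1}$ commute with each other, $H_1$ and $H_{-1}$ commute, and each $H_{\pm1}$ commutes with each of $\Psi^{+},\Psi^-$ (all up to isomorphism); 5. $E_{r+1}E_s\mathbf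 1_k$ is isomorphic to $E_{s+1}E_r\mathbf 1_k[-1]$ if $r-s\ge1$, to $0$ if $r=s$, to $E_{s+1}E_r\mathbf 1_k[1]$ if $r-s\le-1$; and $F_rF_{s+1}\mathbf 1_k$ is isomorphic to $F_sF_{r+1}\mathbf 1_k[1]$ if $r-s\ge 1$, to $0$ if $r=s$, to $F_sF_{r+1}\mathbf 1_k[-1]$ if $r-s\le-1$; 6. $\Psi^\pm E_r\mathbf 1_k\cong E_{r+1}\Psi^\pm\mathbf 1_k[\mp1]$ and $\Psi^\pm F_r\mathbf 1_k\cong F_{r-1}\Psi^\pm\mathbf 1_k[\pm1]$; 7. there are exact triangles $H_1E_r\mathbf 1_k\to E_rH_1\mathbf 1_k\to(E_{r+1}\oplus E_{r+1}[1])\mathbf 1_k$, $\;E_rH_{-1}\mathbf 1_k\to H_{-1}E_r\mathbf 1_k\to(E_{r-1}\oplus E_{r-1}[1])\mathbf 1_k$, $\;F_rH_1\mathbf 1_k\to H_1F_r\mathbf 1_k\to(F_{r+1}\oplus F_{r+1}[1])\mathbf 1_k$, $\;H_{-1}F_r\mathbf 1_k\to F_rH_{-1}\mathbf 1_k\to(F_{r-1}\oplus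 F_{r-1}[1])\mathbf 1_k$; 8. for $-k-1\le r\le0$ and $0\le s\le N-k+1$ there are exact triangles $F_sE_r\mathbf 1_k\to E_rF_s\mathbf 1_k\to Z$ with $Z=\Psi^+H_1\mathbf 1_k$ if $r+s=N-k+1$ and $Z=\Psi^+\mathbf 1_k$ if $r+s=N-k$; exact triangles $E_rF_s\mathbf 1_k\to F_sE_r\mathbf 1_k\to Z$ with $Z=\Psi^-\mathbf 1_k$ if $r+s=-k$ and $Z=\Psi^-H_{-1}\mathbf 1_k$ if $r+s=-k-1$; and $F_sE_r\mathbf 1_k\cong E_rF_s\mathbf 1_k$ if $-k+1\le r+s\le N-k-1$. Let $P(N-k,k)$ be the set of $\lambda=(\lambda_1\ge\dots\ge\lambda_k\ge0)$ with $\lambda_1\le N-k$, and let $F_\lambda\mathbf 1_0=F_{\lambda_1}F_{\lambda_2}\cdots F_{\lambda_k}\mathbf 1_0$ and $$\varphi_k=\bigoplus_{\lambda\in P(N-k,k)}F_\lambda\mathbf 1_0:\ \mathcal K(0,N)\to\mathcal K(k,N-k).$$ A functor between triangulated categories with t-structures is t-exact if it preserves the $\le0$ parts and the $\ge0$ parts.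 **Theorem.** Given such an action, suppose that for each $1\le k\le N$ the image of $\varphi_k$ weakly generates $\mathcal K(k,N-k)$: if $\mathrm{Hom}(\varphi_k(X)[n],Y)=0$ for all $X\in\mathcal K(0,N)$ and $n\in\mathbb Z$, then $Y=0$. Suppose that $\mathcal K(0,N)$ is equipped with a t-structure such that $(F_\lambda)^RF_{\lambda'}\mathbf 1_0$ is t-exact for all $1\le k\le N$ and all $\lambda,\lambda'\in P(N-k,k)$. Then this t-structure extends to t-structures on all the categories $\mathcal K(k,N-k)$, $0\le k\le N$, which for $1\le k\le N$ are pulled back along $(\varphi_k)^R$: $$\mathcal K(k,N-k)^{\le0}=\{X:(\varphi_k)^R(X)\in\mathcal K(0,N)^{\le0}\},\qquad \mathcal K(k,N-k)^{\ge0}=\{X:(\varphi_k)^R(X)\in\mathcal K(0,N)^{\ge0}\}.$$ This is the unique extension for which all the functors $(\varphi_k)^R$ are t-exact. With respect to these t-structures, the functors $$(F_{N-k-1}\mathbf 1_k)^R:\mathcal K(k+1,N-k-1)\to\mathcal K(k,N-k)\quad(0\le k\le N-1),$$ $$(E\mathbf 1_k)^R\,\Psi^-[k-2]:\mathcal K(k-1,N-k+1)\to\mathcal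 K(k,N-k)\quad(1\le k\le N)$$ are t-exact. -/

import Mathlib

open CategoryTheory CategoryTheory.Limits CategoryTheory.Pretriangulated

universe w v u v' u'

/-! ### Exact triangles and t-exact functors -/

section Triangulated

variable {C : Type*} [Category C] [Preadditive C] [HasZeroObject C] [HasShift C ℤ]
  [∀ n : ℤ, (shiftFunctor C n).Additive] [Pretriangulated C]
  {D : Type*} [Category D] [Preadditive D] [HasZeroObject D] [HasShift D ℤ]
  [∀ n : ℤ, (shiftFunctor D n).Additive] [Pretriangulated D]

/-- There is an exact triangle `X → Y → Z → X[1]`. -/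
def ExactTriangle (X Y Z : C) : Prop :=
  ∃ (f : X ⟶ Y) (g : Y ⟶ Z) (h : Z ⟶ X⟦(1 : ℤ)⟧), Triangle.mk f g h ∈ distTriang C

/-- The functor `G` is (left and right) t-exact for the t-structures `s` and `t`. -/
def TExact (s : Triangulated.TStructure C) (t : Triangulated.TStructure D) (G : C ⥤ D) : Prop :=
  (∀ X : C, s.le 0 X → t.le 0 (G.obj X)) ∧ (∀ X : C, s.ge 0 X → t.ge 0 (G.obj X))

/-- A collection of objects weakly generates `C` if an object `Y` with
`Hom(X[n], Y) = 0` for all `X` in the collection and all integers `n` is zero. -/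
def WeaklyGenerates {ι : Type*} (X : ι → C) : Prop :=
  ∀ Y : C, (∀ (i : ι) (n : ℤ) (f : (X i)⟦n⟧ ⟶ Y), f = 0) → IsZero Y

end Triangulated

/-! ### Triangulated 2-categories -/

/-- A `ℂ`-linear, idempotent complete, triangulated 2-category: every category of 1-morphisms is
`ℂ`-linear, triangulated and idempotent complete, and the composition of 1-morphisms is `ℂ`-linear
and exact in each variable. -/
class TriangulatedBicategory (B : Type u) [Bicategory.{w, v} B] where
  [preadditive : ∀ a b : B, Preadditive (a ⟶ b)]
  [linear : ∀ a b : B, Linear ℂ (a ⟶ b)]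
  [hasZeroObject : ∀ a b : B, HasZeroObject (a ⟶ b)]
  [hasShift : ∀ a b : B, HasShift (a ⟶ b) ℤ]
  [shift_additive : ∀ (a b : B) (n : ℤ), (shiftFunctor (a ⟶ b) n).Additive]
  [shift_linear : ∀ (a b : B) (n : ℤ), (shiftFunctor (a ⟶ b) n).Linear ℂ]
  [pretriangulated : ∀ a b : B, Pretriangulated (a ⟶ b)]
  [isTriangulated : ∀ a b : B, IsTriangulated (a ⟶ b)]
  [idempotentComplete : ∀ a b : B, IsIdempotentComplete (a ⟶ b)]
  [precomp_commShift : ∀ {a b : B} (c : B) (f : a ⟶ b),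
    (Bicategory.precomp c f).CommShift ℤ]
  [precomp_isTriangulated : ∀ {a b : B} (c : B) (f : a ⟶ b),
    (Bicategory.precomp c f).IsTriangulated]
  [precomp_linear : ∀ {a b : B} (c : B) (f : a ⟶ b), (Bicategory.precomp c f).Linear ℂ]
  [postcomp_commShift : ∀ (a : B) {b c : B} (g : b ⟶ c),
    (Bicategory.postcomp a g).CommShift ℤ]
  [postcomp_isTriangulated : ∀ (a : B) {b c : B} (g : b ⟶ c),
    (Bicategory.postcomp a g).IsTriangulated]
  [postcomp_linear : ∀ (a : B) {b c : B} (g : b ⟶ c), (Bicategory.postcomp a g).Linear ℂ]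

attribute [reducible] TriangulatedBicategory.preadditive
  TriangulatedBicategory.linear
  TriangulatedBicategory.hasShift
  TriangulatedBicategory.pretriangulated
  TriangulatedBicategory.precomp_commShift
  TriangulatedBicategory.postcomp_commShift

attribute [instance] TriangulatedBicategory.preadditive TriangulatedBicategory.linear
  TriangulatedBicategory.hasZeroObject TriangulatedBicategory.hasShift
  TriangulatedBicategory.shift_additive TriangulatedBicategory.shift_linear
  TriangulatedBicategory.pretriangulated TriangulatedBicategory.isTriangulated
  TriangulatedBicategory.idempotentComplete TriangulatedBicategory.precomp_commShift
  TriangulatedBicategory.precomp_isTriangulated TriangulatedBicategory.precomp_linear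
  TriangulatedBicategory.postcomp_commShift TriangulatedBicategory.postcomp_isTriangulated
  TriangulatedBicategory.postcomp_linear

section Realization

variable {B : Type u} [Bicategory.{w, v} B] (R : Pseudofunctor B Cat.{v', u'})

/-- The functor `K(a) ⥤ K(b)` given by a 1-morphism `a ⟶ b`. -/
abbrev realize {a b : B} (f : a ⟶ b) : R.obj a ⥤ R.obj b := (R.map f).toFunctor

/-- The natural transformation given by a 2-morphism. -/
abbrev realizeMap {a b : B} {f g : a ⟶ b} (α : f ⟶ g) : realize R f ⟶ realize R g :=
  (R.map₂ α).toNatTrans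

/-- Evaluation of 1-morphisms at an object `X` of `K(a)`. -/
@[simps]
def evalAt {a : B} (b : B) (X : R.obj a) : (a ⟶ b) ⥤ R.obj b where
  obj f := (realize R f).obj X
  map α := (realizeMap R α).app X
  map_id f := by simp [realizeMap]
  map_comp α β := by simp [realizeMap]

/-- Evaluation of 1-morphisms is natural in the object of `K(a)`. -/
@[simps]
def evalAtMap {a : B} (b : B) {X Y : R.obj a} (p : X ⟶ Y) : evalAt R b X ⟶ evalAt R b Y where
  app f := (realize R f).map p
  naturality _ _ α := ((realizeMap R α).naturality p).symm

/-- The pseudofunctor `R` presents the objects of a triangulated 2-category as actual `ℂ`-linear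
triangulated categories `K(a)`: the 1-morphisms `a ⟶ b` act as `ℂ`-linear exact functors
`K(a) ⥤ K(b)`, the 2-morphisms act as natural transformations compatible with shifts, and,
for an object `X` of `K(a)`, evaluation at `X` is a `ℂ`-linear exact functor from the category of
1-morphisms `a ⟶ b` to `K(b)`, whose compatibility with shifts is natural in `X`. -/
class TriangulatedRealization [TriangulatedBicategory B] where
  [preadditive : ∀ a : B, Preadditive (R.obj a)]
  [linear : ∀ a : B, Linear ℂ (R.obj a)]
  [hasZeroObject : ∀ a : B, HasZeroObject (R.obj a)]
  [hasShift : ∀ a : B, HasShift (R.obj a) ℤ]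
  [shift_additive : ∀ (a : B) (n : ℤ), (shiftFunctor (R.obj a) n).Additive]
  [shift_linear : ∀ (a : B) (n : ℤ), (shiftFunctor (R.obj a) n).Linear ℂ]
  [pretriangulated : ∀ a : B, Pretriangulated (R.obj a)]
  [isTriangulated : ∀ a : B, IsTriangulated (R.obj a)]
  [realize_commShift : ∀ {a b : B} (f : a ⟶ b), (realize R f).CommShift ℤ]
  [realize_isTriangulated : ∀ {a b : B} (f : a ⟶ b), (realize R f).IsTriangulated]
  [realize_linear : ∀ {a b : B} (f : a ⟶ b), (realize R f).Linear ℂ]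
  [realizeMap_commShift : ∀ {a b : B} {f g : a ⟶ b} (α : f ⟶ g),
    NatTrans.CommShift (realizeMap R α) ℤ]
  [evalAt_commShift : ∀ {a : B} (b : B) (X : R.obj a), (evalAt R b X).CommShift ℤ]
  [evalAt_isTriangulated : ∀ {a : B} (b : B) (X : R.obj a), (evalAt R b X).IsTriangulated]
  [evalAt_linear : ∀ {a : B} (b : B) (X : R.obj a), (evalAt R b X).Linear ℂ]
  [evalAtMap_commShift : ∀ {a : B} (b : B) {X Y : R.obj a} (p : X ⟶ Y),
    NatTrans.CommShift (evalAtMap R b p) ℤ]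

attribute [reducible] TriangulatedRealization.preadditive
  TriangulatedRealization.linear
  TriangulatedRealization.hasShift
  TriangulatedRealization.pretriangulated
  TriangulatedRealization.realize_commShift
  TriangulatedRealization.evalAt_commShift

attribute [instance] TriangulatedRealization.preadditive TriangulatedRealization.linear
  TriangulatedRealization.hasZeroObject TriangulatedRealization.hasShift
  TriangulatedRealization.shift_additive TriangulatedRealization.shift_linear
  TriangulatedRealization.pretriangulated TriangulatedRealization.isTriangulated
  TriangulatedRealization.realize_commShift TriangulatedRealization.realize_isTriangulated
  TriangulatedRealization.realize_linear TriangulatedRealization.realizeMap_commShift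
  TriangulatedRealization.evalAt_commShift TriangulatedRealization.evalAt_isTriangulated
  TriangulatedRealization.evalAt_linear TriangulatedRealization.evalAtMap_commShift

end Realization

/-! ### Categorical actions -/

section Powers

variable {B : Type u} [Bicategory.{w, v} B]

/-- Powers of a 1-endomorphism. -/
def oneMorphismPow {a : B} (f : a ⟶ a) : ℕ → (a ⟶ a)
  | 0 => 𝟙 a
  | n + 1 => oneMorphismPow f n ≫ f

/-- Integer powers of a 1-endomorphism `f` with inverse `g`. -/
def oneMorphismZPow {a : B} (f g : a ⟶ a) : ℤ → (a ⟶ a)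
  | Int.ofNat n => oneMorphismPow f n
  | Int.negSucc n => oneMorphismPow g (n + 1)

end Powers

/-- The generating 1-morphisms of a categorical action. The weight `(k, N - k)` is recorded by the
integer `k`. Compositions are written in diagrammatic order: `f ≫ g` is "first `f`, then `g`". -/
structure ActionData (B : Type u) [Bicategory.{w, v} B] where
  /-- The weight `(k, N - k)`. -/
  wt : ℤ → B
  /-- `E r h` is `E_r 1_(k, N-k)`, where `h : j + 1 = k`. -/
  E : ∀ (_ : ℤ) {j k : ℤ} (_ : j + 1 = k), wt k ⟶ wt j
  /-- `F s h` is `F_s 1_(j, N-j)`, where `h : j + 1 = k`. -/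
  F : ∀ (_ : ℤ) {j k : ℤ} (_ : j + 1 = k), wt j ⟶ wt k
  /-- `Psi ε δ k` is `(Ψ^ε)^δ 1_(k, N-k)` for signs `ε`, `δ`. -/
  Psi : ∀ (_ _ : ℤˣ) (k : ℤ), wt k ⟶ wt k
  /-- `H ε k` is `H_ε 1_(k, N-k)` for a sign `ε`. -/
  H : ∀ (_ : ℤˣ) (k : ℤ), wt k ⟶ wt k

namespace ActionData

variable {B : Type u} [Bicategory.{w, v} B] (A : ActionData B)

/-- `(Ψ^ε)^n 1_(k, N-k)` for an integer `n`. -/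
def PsiPow (ε : ℤˣ) (n k : ℤ) : A.wt k ⟶ A.wt k :=
  oneMorphismZPow (A.Psi ε 1 k) (A.Psi ε (-1) k) n

/-- `F_{l_1} F_{l_2} ⋯ F_{l_k} 1_(0, N)`; the functor `F_{l_k}` is applied first. -/
def FWord : ∀ (k : ℕ) (_ : Fin k → ℕ), A.wt 0 ⟶ A.wt (k : ℤ)
  | 0, _ => 𝟙 (A.wt 0)
  | k + 1, l => FWord k (fun i => l i.succ) ≫ A.F (l 0 : ℤ) (Nat.cast_succ k).symm

end ActionData

/-- The Young diagrams `l = (l_1 ≥ ⋯ ≥ l_b ≥ 0)` with `l_1 ≤ a` and at most `b` rows. -/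
def BoxPartition (a b : ℕ) : Type := {l : Fin b → Fin (a + 1) // Antitone l}

instance (a b : ℕ) : Finite (BoxPartition a b) :=
  inferInstanceAs (Finite {l : Fin b → Fin (a + 1) // Antitone l})

/-- The rows of a Young diagram. -/
def BoxPartition.row {a b : ℕ} (l : BoxPartition a b) (i : Fin b) : ℕ := (l.1 i : ℕ)

section Action

variable {B : Type u} [Bicategory.{w, v} B] [TriangulatedBicategory B]

/-- The relations of a categorical action of the shifted `q = 0` affine algebra
`U_{0,N}(L sl_2)`. The weights `(k, N - k)` with `k < 0` or `k > N` are zero. The 1-morphism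
`E_r 1_(k, N-k)` only matters for `-k-1 ≤ r ≤ 0`, and `F_s 1_(k, N-k)` only for `0 ≤ s ≤ N-k+1`:
a relation is imposed as soon as all generators in it are in this range. -/
structure IsCategoricalAction (N : ℕ) (A : ActionData B) : Prop where
  isZero_wt : ∀ k : ℤ, k < 0 ∨ (N : ℤ) < k → IsZero (𝟙 (A.wt k))
  finiteDimensional : ∀ (k l : ℤ) (f g : A.wt k ⟶ A.wt l), FiniteDimensional ℂ (f ⟶ g)
  H_adj : ∀ (ε : ℤˣ) (k : ℤ), 0 ≤ k → k ≤ N →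
    Nonempty (Bicategory.Adjunction (A.H ε k) (A.H (-ε) k))
  E_rightAdj : ∀ (r : ℤ) {j k : ℤ} (h : j + 1 = k), 0 ≤ k → k ≤ N → -k - 1 ≤ r → r ≤ 0 →
    Nonempty (Bicategory.Adjunction (A.E r h)
      ((A.PsiPow 1 (-r - 2) j ≫ A.F (N - k + 2) h ≫ A.PsiPow 1 (r + 1) k)⟦-r - 1⟧))
  E_leftAdj : ∀ (r : ℤ) {j k : ℤ} (h : j + 1 = k), 0 ≤ k → k ≤ N → -k - 1 ≤ r → r ≤ 0 →
    Nonempty (Bicategory.Adjunction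
      ((A.PsiPow (-1) (-r - k) j ≫ A.F 0 h ≫ A.PsiPow (-1) (r + k - 1) k)⟦r + k⟧) (A.E r h))
  F_rightAdj : ∀ (s : ℤ) {k l : ℤ} (h : k + 1 = l), 0 ≤ k → k ≤ N → 0 ≤ s → s ≤ N - k + 1 →
    Nonempty (Bicategory.Adjunction (A.F s h)
      ((A.PsiPow (-1) (s - 2) l ≫ A.E (-k - 2) h ≫ A.PsiPow (-1) (-s + 1) k)⟦s - 1⟧))
  F_leftAdj : ∀ (s : ℤ) {k l : ℤ} (h : k + 1 = l), 0 ≤ k → k ≤ N → 0 ≤ s → s ≤ N - k + 1 →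
    Nonempty (Bicategory.Adjunction
      ((A.PsiPow 1 (s - N + k) l ≫ A.E 0 h ≫ A.PsiPow 1 (-s + N - k - 1) k)⟦-s + N - k⟧)
      (A.F s h))
  Psi_inv : ∀ (ε δ : ℤˣ) (k : ℤ), 0 ≤ k → k ≤ N →
    Nonempty (A.Psi ε δ k ≫ A.Psi ε (-δ) k ≅ 𝟙 (A.wt k))
  Psi_comm : ∀ (ε δ ε' δ' : ℤˣ) (k : ℤ), 0 ≤ k → k ≤ N →
    Nonempty (A.Psi ε δ k ≫ A.Psi ε' δ' k ≅ A.Psi ε' δ' k ≫ A.Psi ε δ k)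
  H_comm : ∀ (ε ε' : ℤˣ) (k : ℤ), 0 ≤ k → k ≤ N →
    Nonempty (A.H ε k ≫ A.H ε' k ≅ A.H ε' k ≫ A.H ε k)
  H_Psi_comm : ∀ (ε ε' : ℤˣ) (k : ℤ), 0 ≤ k → k ≤ N →
    Nonempty (A.Psi ε' 1 k ≫ A.H ε k ≅ A.H ε k ≫ A.Psi ε' 1 k)
  E_E_gt : ∀ (r s : ℤ) {i j k : ℤ} (hi : i + 1 = j) (hj : j + 1 = k), 0 ≤ k → k ≤ N →
    -k - 1 ≤ r → r ≤ -1 → -k - 1 ≤ s → s ≤ -1 → 1 ≤ r - s →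
    Nonempty (A.E s hj ≫ A.E (r + 1) hi ≅ (A.E r hj ≫ A.E (s + 1) hi)⟦(-1 : ℤ)⟧)
  E_E_eq : ∀ (r : ℤ) {i j k : ℤ} (hi : i + 1 = j) (hj : j + 1 = k), 0 ≤ k → k ≤ N →
    -k - 1 ≤ r → r ≤ -1 → IsZero (A.E r hj ≫ A.E (r + 1) hi)
  E_E_lt : ∀ (r s : ℤ) {i j k : ℤ} (hi : i + 1 = j) (hj : j + 1 = k), 0 ≤ k → k ≤ N →
    -k - 1 ≤ r → r ≤ -1 → -k - 1 ≤ s → s ≤ -1 → r - s ≤ -1 →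
    Nonempty (A.E s hj ≫ A.E (r + 1) hi ≅ (A.E r hj ≫ A.E (s + 1) hi)⟦(1 : ℤ)⟧)
  F_F_gt : ∀ (r s : ℤ) {k l m : ℤ} (hk : k + 1 = l) (hl : l + 1 = m), 0 ≤ k → k ≤ N →
    0 ≤ r → r ≤ N - k → 0 ≤ s → s ≤ N - k → 1 ≤ r - s →
    Nonempty (A.F (s + 1) hk ≫ A.F r hl ≅ (A.F (r + 1) hk ≫ A.F s hl)⟦(1 : ℤ)⟧)
  F_F_eq : ∀ (r : ℤ) {k l m : ℤ} (hk : k + 1 = l) (hl : l + 1 = m), 0 ≤ k → k ≤ N →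
    0 ≤ r → r ≤ N - k → IsZero (A.F (r + 1) hk ≫ A.F r hl)
  F_F_lt : ∀ (r s : ℤ) {k l m : ℤ} (hk : k + 1 = l) (hl : l + 1 = m), 0 ≤ k → k ≤ N →
    0 ≤ r → r ≤ N - k → 0 ≤ s → s ≤ N - k → r - s ≤ -1 →
    Nonempty (A.F (s + 1) hk ≫ A.F r hl ≅ (A.F (r + 1) hk ≫ A.F s hl)⟦(-1 : ℤ)⟧)
  E_Psi : ∀ (ε : ℤˣ) (r : ℤ) {j k : ℤ} (h : j + 1 = k), 0 ≤ k → k ≤ N →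
    -k - 1 ≤ r → r ≤ -1 →
    Nonempty (A.E r h ≫ A.Psi ε 1 j ≅ (A.Psi ε 1 k ≫ A.E (r + 1) h)⟦-(ε : ℤ)⟧)
  F_Psi : ∀ (ε : ℤˣ) (s : ℤ) {k l : ℤ} (h : k + 1 = l), 0 ≤ k → k ≤ N →
    1 ≤ s → s ≤ N - k + 1 →
    Nonempty (A.F s h ≫ A.Psi ε 1 l ≅ (A.Psi ε 1 k ≫ A.F (s - 1) h)⟦(ε : ℤ)⟧)
  E_H_one : ∀ (r : ℤ) {j k : ℤ} (h : j + 1 = k), 0 ≤ k → k ≤ N → -k - 1 ≤ r → r ≤ -1 →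
    ExactTriangle (A.E r h ≫ A.H 1 j) (A.H 1 k ≫ A.E r h)
      (A.E (r + 1) h ⊞ (A.E (r + 1) h)⟦(1 : ℤ)⟧)
  E_H_neg_one : ∀ (r : ℤ) {j k : ℤ} (h : j + 1 = k), 0 ≤ k → k ≤ N → -k ≤ r → r ≤ 0 →
    ExactTriangle (A.H (-1) k ≫ A.E r h) (A.E r h ≫ A.H (-1) j)
      (A.E (r - 1) h ⊞ (A.E (r - 1) h)⟦(1 : ℤ)⟧)
  F_H_one : ∀ (s : ℤ) {k l : ℤ} (h : k + 1 = l), 0 ≤ k → k ≤ N → 0 ≤ s → s ≤ N - k →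
    ExactTriangle (A.H 1 k ≫ A.F s h) (A.F s h ≫ A.H 1 l)
      (A.F (s + 1) h ⊞ (A.F (s + 1) h)⟦(1 : ℤ)⟧)
  F_H_neg_one : ∀ (s : ℤ) {k l : ℤ} (h : k + 1 = l), 0 ≤ k → k ≤ N → 1 ≤ s → s ≤ N - k + 1 →
    ExactTriangle (A.F s h ≫ A.H (-1) l) (A.H (-1) k ≫ A.F s h)
      (A.F (s - 1) h ⊞ (A.F (s - 1) h)⟦(1 : ℤ)⟧)
  E_F_top_succ : ∀ (r s : ℤ) {j k l : ℤ} (hj : j + 1 = k) (hk : k + 1 = l), 0 ≤ k → k ≤ N →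
    -k - 1 ≤ r → r ≤ 0 → 0 ≤ s → s ≤ N - k + 1 → r + s = N - k + 1 →
    ExactTriangle (A.E r hj ≫ A.F s hj) (A.F s hk ≫ A.E r hk) (A.H 1 k ≫ A.Psi 1 1 k)
  E_F_top : ∀ (r s : ℤ) {j k l : ℤ} (hj : j + 1 = k) (hk : k + 1 = l), 0 ≤ k → k ≤ N →
    -k - 1 ≤ r → r ≤ 0 → 0 ≤ s → s ≤ N - k + 1 → r + s = N - k →
    ExactTriangle (A.E r hj ≫ A.F s hj) (A.F s hk ≫ A.E r hk) (A.Psi 1 1 k)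
  E_F_bot : ∀ (r s : ℤ) {j k l : ℤ} (hj : j + 1 = k) (hk : k + 1 = l), 0 ≤ k → k ≤ N →
    -k - 1 ≤ r → r ≤ 0 → 0 ≤ s → s ≤ N - k + 1 → r + s = -k →
    ExactTriangle (A.F s hk ≫ A.E r hk) (A.E r hj ≫ A.F s hj) (A.Psi (-1) 1 k)
  E_F_bot_pred : ∀ (r s : ℤ) {j k l : ℤ} (hj : j + 1 = k) (hk : k + 1 = l), 0 ≤ k → k ≤ N →
    -k - 1 ≤ r → r ≤ 0 → 0 ≤ s → s ≤ N - k + 1 → r + s = -k - 1 →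
    ExactTriangle (A.F s hk ≫ A.E r hk) (A.E r hj ≫ A.F s hj) (A.H (-1) k ≫ A.Psi (-1) 1 k)
  E_F_mid : ∀ (r s : ℤ) {j k l : ℤ} (hj : j + 1 = k) (hk : k + 1 = l), 0 ≤ k → k ≤ N →
    -k - 1 ≤ r → r ≤ 0 → 0 ≤ s → s ≤ N - k + 1 → -k + 1 ≤ r + s → r + s ≤ N - k - 1 →
    Nonempty (A.E r hj ≫ A.F s hj ≅ A.F s hk ≫ A.E r hk)

/-- The 1-morphism `φ_k`, the direct sum of all `F_l 1_(0, N)` for `l` in `P(N - k, k)`. -/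
noncomputable def ActionData.phi (A : ActionData B) (N k : ℕ) : A.wt 0 ⟶ A.wt (k : ℤ) :=
  ⨁ fun l : BoxPartition (N - k) k => A.FWord k l.row

end Action

/-! The words `F_λ 1_0`, ordered lexicographically, form a semiorthogonal family of fully faithful
functors: `(F_λ)^R F_λ ≅ 1`, and `(F_λ)^R F_μ = 0` for `λ < μ`. Both follow from the relations. Up
to powers of `Ψ⁻` and a shift, `(F_s)^R` is some `E_r`; it is commuted past `F_m` until it reaches a
zero weight, and only the boundary triangle with third term `Ψ⁻` leaves a contribution
(`cls_F_comp_FWordRight`, `cls_F_comp_FRight_comp_FWordRight`).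

Weak generation says that the `(F_λ)^R` jointly detect zero objects. For a finite semiorthogonal
family with this property, a t-structure on the source glues to the one whose halves are tested by
all right adjoints, as soon as `(F_λ)^R F_μ` preserves the `≤ 0` part (`exists_triangle_finset`,
`gluedTStructure`). Since `(φ_k)^R` is the direct sum of the `(F_λ)^R`, this is the t-structure
pulled back along `(φ_k)^R`.

Exactness of the two families of functors is combinatorics of words. Composing `(F_λ)^R` with
`(F_{N-k-1})^R` gives the right adjoint of the word with the row `N-k-1` put in front, or zero. The
left adjoint of `(F_λ)^R (E)^R Ψ⁻[k-2]` deletes a last row equal to zero and raises the remaining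
rows by one, or is zero. Uniqueness holds because each half of a t-structure is the orthogonal of
the other. -/

/-! ### Isomorphism classes of 1-morphisms -/

/-- The category with the objects of `B`, and isomorphism classes of 1-morphisms as morphisms. -/
structure IsoClassCat (B : Type u) where
  /-- The underlying object of the bicategory. -/
  as : B

namespace IsoClassCat

open scoped Bicategory ZeroObject

section Basic

variable {B : Type u} [Bicategory.{w, v} B]

/-- The relations hold only up to unspecified isomorphism. On isomorphism classes they become
equations, associators disappear, and long words can be rewritten. -/
instance : Category (IsoClassCat B) where
  Hom a b := Quotient (isIsomorphicSetoid (a.as ⟶ b.as))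
  id a := Quotient.mk _ (𝟙 a.as)
  comp f g := Quotient.map₂ (fun f g => f ≫ g)
    (by
      rintro _ _ ⟨e⟩ _ _ ⟨e'⟩
      exact ⟨Bicategory.whiskerRightIso e _ ≪≫ Bicategory.whiskerLeftIso _ e'⟩) f g
  id_comp f := by
    obtain ⟨f, rfl⟩ := Quotient.exists_rep f
    exact Quotient.sound ⟨λ_ f⟩
  comp_id f := by
    obtain ⟨f, rfl⟩ := Quotient.exists_rep f
    exact Quotient.sound ⟨ρ_ f⟩
  assoc f g h := by
    obtain ⟨f, rfl⟩ := Quotient.exists_rep f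
    obtain ⟨g, rfl⟩ := Quotient.exists_rep g
    obtain ⟨h, rfl⟩ := Quotient.exists_rep h
    exact Quotient.sound ⟨α_ f g h⟩

/-- The isomorphism class of a 1-morphism. -/
def cls {a b : B} (f : a ⟶ b) : IsoClassCat.mk a ⟶ IsoClassCat.mk b := Quotient.mk _ f

lemma cls_surjective {X Y : IsoClassCat B} (f : X ⟶ Y) :
    ∃ g : X.as ⟶ Y.as, f = cls g := by
  obtain ⟨g, rfl⟩ := Quotient.exists_rep f
  exact ⟨g, rfl⟩

lemma cls_eq_iff {a b : B} {f g : a ⟶ b} : cls f = cls g ↔ Nonempty (f ≅ g) :=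
  Quotient.eq

lemma cls_comp {a b c : B} (f : a ⟶ b) (g : b ⟶ c) : cls (f ≫ g) = cls f ≫ cls g := rfl

end Basic

variable {B : Type u} [Bicategory.{w, v} B] [TriangulatedBicategory B]

noncomputable instance : HasZeroMorphisms (IsoClassCat B) where
  zero X Y := ⟨cls (0 : X.as ⟶ Y.as)⟩
  comp_zero {X Y} f Z := by
    obtain ⟨f, rfl⟩ := cls_surjective f
    exact cls_eq_iff.2
      ⟨((Bicategory.precomp Z.as f).map_isZero (isZero_zero _)).iso (isZero_zero _)⟩
  zero_comp X {Y Z} f := by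
    obtain ⟨f, rfl⟩ := cls_surjective f
    exact cls_eq_iff.2
      ⟨((Bicategory.postcomp X.as f).map_isZero (isZero_zero _)).iso (isZero_zero _)⟩

lemma cls_eq_zero_iff {a b : B} {f : a ⟶ b} : cls f = 0 ↔ IsZero f :=
  cls_eq_iff.trans ⟨fun ⟨e⟩ => (isZero_zero _).of_iso e, fun h => ⟨h.iso (isZero_zero _)⟩⟩

/-- The shift on isomorphism classes of 1-morphisms. -/
def sh (n : ℤ) {X Y : IsoClassCat B} (f : X ⟶ Y) : X ⟶ Y :=
  Quotient.map (fun f : X.as ⟶ Y.as => f⟦n⟧) (by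
    rintro _ _ ⟨e⟩
    exact ⟨(shiftFunctor _ n).mapIso e⟩) f

lemma cls_shift {a b : B} (f : a ⟶ b) (n : ℤ) : cls (f⟦n⟧) = sh n (cls f) := rfl

@[simp]
lemma sh_zero {X Y : IsoClassCat B} (f : X ⟶ Y) : sh 0 f = f := by
  obtain ⟨f, rfl⟩ := cls_surjective f
  exact cls_eq_iff.2 ⟨(shiftFunctorZero _ ℤ).app f⟩

@[simp]
lemma sh_sh {X Y : IsoClassCat B} (m n : ℤ) (f : X ⟶ Y) : sh m (sh n f) = sh (n + m) f := by
  obtain ⟨f, rfl⟩ := cls_surjective f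
  exact cls_eq_iff.2 ⟨((shiftFunctorAdd _ n m).app f).symm⟩

@[simp]
lemma sh_zero_hom {X Y : IsoClassCat B} (n : ℤ) : sh n (0 : X ⟶ Y) = 0 :=
  cls_eq_iff.2 ⟨((shiftFunctor (X.as ⟶ Y.as) n).map_isZero (isZero_zero _)).iso (isZero_zero _)⟩

@[simp]
lemma comp_sh {X Y Z : IsoClassCat B} (n : ℤ) (f : X ⟶ Y) (g : Y ⟶ Z) :
    f ≫ sh n g = sh n (f ≫ g) := by
  obtain ⟨f, rfl⟩ := cls_surjective f
  obtain ⟨g, rfl⟩ := cls_surjective g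
  exact cls_eq_iff.2 ⟨((Bicategory.precomp Z.as f).commShiftIso n).app g⟩

@[simp]
lemma sh_comp {X Y Z : IsoClassCat B} (n : ℤ) (f : X ⟶ Y) (g : Y ⟶ Z) :
    sh n f ≫ g = sh n (f ≫ g) := by
  obtain ⟨f, rfl⟩ := cls_surjective f
  obtain ⟨g, rfl⟩ := cls_surjective g
  exact cls_eq_iff.2 ⟨((Bicategory.postcomp X.as g).commShiftIso n).app f⟩

lemma eq_sh_of_sh_eq {X Y : IsoClassCat B} {n : ℤ} {f g : X ⟶ Y} (h : sh n f = g) :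
    f = sh (-n) g := by
  rw [← h, sh_sh, add_neg_cancel, sh_zero]

end IsoClassCat

open IsoClassCat

/-! ### Exact triangles of 1-morphisms with zero middle term -/

section

variable {B : Type u} [Bicategory.{w, v} B] [TriangulatedBicategory B]

/-- In an exact triangle `P → Q → R` with `Q = 0`, the third object is `P[1]`. -/
lemma ExactTriangle.cls_eq_of_isZero₂ {a b : B} {P Q R : a ⟶ b} (h : ExactTriangle P Q R)
    (hQ : IsZero Q) : cls R = sh 1 (cls P) := by
  obtain ⟨f, g, h, hT⟩ := h
  have : IsIso h := (Triangle.isZero₂_iff_isIso₃ _ hT).1 hQ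
  exact cls_eq_iff.2 ⟨asIso h⟩

lemma ExactTriangle.map {C D : Type*} [Category C] [Category D] [Preadditive C] [Preadditive D]
    [HasZeroObject C] [HasZeroObject D] [HasShift C ℤ] [HasShift D ℤ]
    [∀ n : ℤ, (shiftFunctor C n).Additive] [∀ n : ℤ, (shiftFunctor D n).Additive]
    [Pretriangulated C] [Pretriangulated D] (G : C ⥤ D) [G.CommShift ℤ] [G.IsTriangulated]
    {X Y Z : C} (h : ExactTriangle X Y Z) : ExactTriangle (G.obj X) (G.obj Y) (G.obj Z) := by
  obtain ⟨f, g, h, hT⟩ := h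
  exact ⟨_, _, _, G.map_distinguished _ hT⟩

/-- Composing an exact triangle `P → Q → R` on both sides, so that `Q` becomes zero. -/
lemma ExactTriangle.cls_comp_eq {a b x y : B} {P Q R : a ⟶ b} (h : ExactTriangle P Q R)
    (f : x ⟶ a) (g : b ⟶ y) (hQ : cls f ≫ cls Q ≫ cls g = 0) :
    cls f ≫ cls R ≫ cls g = sh 1 (cls f ≫ cls P ≫ cls g) :=
  ExactTriangle.cls_eq_of_isZero₂
    ((h.map (Bicategory.postcomp a g)).map (Bicategory.precomp y f)) (cls_eq_zero_iff.1 hQ)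

end

/-! ### Words in the generators -/

namespace IsoClassCat

variable {B : Type u} [Bicategory.{w, v} B]

/-- Identifies the recursive powers with powers in a unit group, where the law of exponents is
available. -/
lemma cls_oneMorphismZPow {a : B} (f g : a ⟶ a) (p : (End (IsoClassCat.mk a))ˣ)
    (hf : p.val = cls f) (hg : p⁻¹.val = cls g) (n : ℤ) :
    cls (oneMorphismZPow f g n) = (p ^ n).val := by
  have h (f : a ⟶ a) (q : (End (IsoClassCat.mk a))ˣ) (hf : q.val = cls f) (n : ℕ) :
      cls (oneMorphismPow f n) = (q ^ n).val := by
    induction n with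
    | zero => rfl
    | succ n ih =>
      rw [pow_succ', Units.val_mul, End.mul_def, ← ih, hf]
      rfl
  cases n with
  | ofNat n =>
    rw [Int.ofNat_eq_natCast, zpow_natCast]
    exact h f p hf n
  | negSucc n =>
    rw [zpow_negSucc, ← inv_pow]
    exact h g _ hg (n + 1)

end IsoClassCat

variable {B : Type u} [Bicategory.{w, v} B]

namespace ActionData

lemma cls_PsiPow_zero (A : ActionData B) (ε : ℤˣ) (k : ℤ) : cls (A.PsiPow ε 0 k) = 𝟙 _ := rfl

lemma cls_PsiPow_one (A : ActionData B) (ε : ℤˣ) (k : ℤ) :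
    cls (A.PsiPow ε 1 k) = cls (A.Psi ε 1 k) := Category.id_comp (cls (A.Psi ε 1 k))

lemma cls_PsiPow_neg_one (A : ActionData B) (ε : ℤˣ) (k : ℤ) :
    cls (A.PsiPow ε (-1) k) = cls (A.Psi ε (-1) k) := Category.id_comp (cls (A.Psi ε (-1) k))

lemma cls_FWord_succ (A : ActionData B) (k : ℕ) (l : Fin (k + 1) → ℕ) :
    cls (A.FWord (k + 1) l) =
      cls (A.FWord k fun i => l i.succ) ≫ cls (A.F (l 0 : ℤ) (Nat.cast_succ k).symm) := rfl

end ActionData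

variable [TriangulatedBicategory B]

namespace ActionData

/-- The right adjoint of `F_s 1_(k, N - k)`. -/
def FRight (A : ActionData B) (s : ℤ) {k l : ℤ} (h : k + 1 = l) : A.wt l ⟶ A.wt k :=
  (A.PsiPow (-1) (s - 2) l ≫ A.E (-k - 2) h ≫ A.PsiPow (-1) (-s + 1) k)⟦s - 1⟧

/-- The right adjoint of `F_{l_1} F_{l_2} ⋯ F_{l_k} 1_(0, N)`. -/
def FWordRight (A : ActionData B) : ∀ (k : ℕ) (_ : Fin k → ℕ), A.wt (k : ℤ) ⟶ A.wt 0
  | 0, _ => 𝟙 (A.wt 0)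
  | k + 1, l => A.FRight (l 0 : ℤ) (Nat.cast_succ k).symm ≫ A.FWordRight k (fun i => l i.succ)

lemma cls_FWordRight_succ (A : ActionData B) (k : ℕ) (l : Fin (k + 1) → ℕ) :
    cls (A.FWordRight (k + 1) l) =
      cls (A.FRight (l 0 : ℤ) (Nat.cast_succ k).symm) ≫
        cls (A.FWordRight k fun i => l i.succ) := rfl

end ActionData

namespace IsCategoricalAction

variable {N : ℕ} {A : ActionData B} (hA : IsCategoricalAction N A)

include hA

lemma cls_eq_zero_of_source {k l : ℤ} (hk : k < 0 ∨ (N : ℤ) < k)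
    (f : IsoClassCat.mk (A.wt k) ⟶ IsoClassCat.mk (A.wt l)) : f = 0 := by
  have h : 𝟙 (IsoClassCat.mk (A.wt k)) = 0 := cls_eq_zero_iff.2 (hA.isZero_wt k hk)
  rw [← Category.id_comp f, h, zero_comp]

lemma cls_eq_zero_of_target {k l : ℤ} (hl : l < 0 ∨ (N : ℤ) < l)
    (f : IsoClassCat.mk (A.wt k) ⟶ IsoClassCat.mk (A.wt l)) : f = 0 := by
  have h : 𝟙 (IsoClassCat.mk (A.wt l)) = 0 := cls_eq_zero_iff.2 (hA.isZero_wt l hl)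
  rw [← Category.comp_id f, h, comp_zero]

/-! #### Powers of `Ψ⁻` -/

lemma cls_PsiPow_add {k : ℤ} (h0 : 0 ≤ k) (hN : k ≤ N) (ε : ℤˣ) (m n : ℤ) :
    cls (A.PsiPow ε m k) ≫ cls (A.PsiPow ε n k) = cls (A.PsiPow ε (m + n) k) := by
  let p : (End (IsoClassCat.mk (A.wt k)))ˣ :=
    { val := cls (A.Psi ε 1 k)
      inv := cls (A.Psi ε (-1) k)
      val_inv := by
        have := cls_eq_iff.2 (hA.Psi_inv ε (-1) k h0 hN)
        rwa [neg_neg] at this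
      inv_val := cls_eq_iff.2 (hA.Psi_inv ε 1 k h0 hN) }
  have h (n : ℤ) : cls (A.PsiPow ε n k) = (p ^ n).val :=
    cls_oneMorphismZPow _ _ p rfl rfl n
  -- Multiplication in `End` is opposite to diagrammatic composition, hence `add_comm`.
  rw [h, h, h, add_comm, zpow_add]
  rfl

lemma cls_PsiPow_add_assoc {k : ℤ} (h0 : 0 ≤ k) (hN : k ≤ N) (ε : ℤˣ) (m n : ℤ)
    {Z : IsoClassCat B} (f : IsoClassCat.mk (A.wt k) ⟶ Z) :
    cls (A.PsiPow ε m k) ≫ cls (A.PsiPow ε n k) ≫ f = cls (A.PsiPow ε (m + n) k) ≫ f := by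
  rw [← Category.assoc, hA.cls_PsiPow_add h0 hN]

/-- Each `Ψ⁻` that crosses `F` lowers its index by one and shifts by `-1`; the bounds keep every
intermediate index in the permitted range. -/
lemma cls_F_comp_PsiPow_nat {k l : ℤ} (h : k + 1 = l) (h0 : 0 ≤ k) (hN : l ≤ N) (n : ℕ) (s : ℤ)
    (hs : 0 ≤ s - n) (hs' : s ≤ N - k + 1) :
    cls (A.F s h) ≫ cls (A.PsiPow (-1) n l) =
      sh (-n) (cls (A.PsiPow (-1) n k) ≫ cls (A.F (s - n) h)) := by
  induction n with
  | zero => simp [ActionData.cls_PsiPow_zero]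
  | succ n ih =>
    have hF : cls (A.F (s - n) h) ≫ cls (A.PsiPow (-1) 1 l) =
        sh (-1) (cls (A.PsiPow (-1) 1 k) ≫ cls (A.F (s - n - 1) h)) := by
      rw [ActionData.cls_PsiPow_one, ActionData.cls_PsiPow_one]
      exact cls_eq_iff.2 (hA.F_Psi (-1) (s - n) h h0 (by lia) (by lia) (by lia))
    rw [Nat.cast_succ, ← hA.cls_PsiPow_add (by lia) hN, ← Category.assoc, ih (by lia), sh_comp,
      Category.assoc, hF, comp_sh, sh_sh, hA.cls_PsiPow_add_assoc h0 (by lia)]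
    congr 2
    · ring
    · rw [show s - ((n : ℤ) + 1) = s - n - 1 by ring]

/-- Powers of `Ψ⁻` move past `F_s` up to a shift. -/
lemma cls_F_comp_PsiPow {k l : ℤ} (h : k + 1 = l) (h0 : 0 ≤ k) (hN : l ≤ N) (n s : ℤ)
    (hs : 0 ≤ s) (hs' : s ≤ N - k + 1) (hn : 0 ≤ s - n) (hn' : s - n ≤ N - k + 1) :
    cls (A.F s h) ≫ cls (A.PsiPow (-1) n l) =
      sh (-n) (cls (A.PsiPow (-1) n k) ≫ cls (A.F (s - n) h)) := by
  obtain ⟨m, rfl | rfl⟩ := Int.eq_nat_or_neg n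
  · exact hA.cls_F_comp_PsiPow_nat h h0 hN m s hn hs'
  -- Negative exponents: start from `F_{s+m}` and compose the relation with `(Ψ⁻)^{-m}` on both
  -- sides.
  · have key := hA.cls_F_comp_PsiPow_nat h h0 hN m (s - -m) (by lia) hn'
    rw [show s - -(m : ℤ) - m = s by ring] at key
    have key' := congr(cls (A.PsiPow (-1) (-m) k) ≫ $key ≫ cls (A.PsiPow (-1) (-m) l))
    simp only [sh_comp, comp_sh, Category.assoc, hA.cls_PsiPow_add (show 0 ≤ l by lia) hN,
      hA.cls_PsiPow_add_assoc h0 (show k ≤ N by lia), add_neg_cancel, neg_add_cancel,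
      ActionData.cls_PsiPow_zero, Category.comp_id, Category.id_comp] at key'
    rw [eq_sh_of_sh_eq key'.symm, neg_neg]

/-! #### Composites of `F_m` with the right adjoint of `F_s` -/

/-- The commutation relations at weight `k` require an index of `E` at least `-k-1`, so one `Ψ⁻` is
moved across `E_{-k-2}` to raise its index. -/
lemma cls_FRight {k l : ℤ} (h : k + 1 = l) (h0 : 0 ≤ k) (hN : l ≤ N) (s : ℤ) :
    cls (A.FRight s h) =
      sh s (cls (A.PsiPow (-1) (s - 1) l) ≫ cls (A.E (-k - 1) h) ≫
        cls (A.PsiPow (-1) (-s) k)) := by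
  have hE : cls (A.E (-k - 2) h) ≫ cls (A.PsiPow (-1) 1 k) =
      sh 1 (cls (A.PsiPow (-1) 1 l) ≫ cls (A.E (-k - 1) h)) := by
    rw [ActionData.cls_PsiPow_one, ActionData.cls_PsiPow_one, show -k - 1 = -k - 2 + 1 by ring]
    exact cls_eq_iff.2 (hA.E_Psi (-1) (-k - 2) h (by lia) hN (by lia) (by lia))
  rw [ActionData.FRight, cls_shift, cls_comp, cls_comp, show -s + 1 = 1 + -s by ring,
    ← hA.cls_PsiPow_add h0 (by lia), ← Category.assoc (cls (A.E (-k - 2) h)), hE]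
  simp only [sh_comp, comp_sh, sh_sh, Category.assoc]
  rw [hA.cls_PsiPow_add_assoc (by lia) hN]
  congr 3 <;> ring_nf

lemma cls_F_comp_FRight {k l : ℤ} (h : k + 1 = l) (h0 : 0 ≤ k) (hN : l ≤ N) (s m : ℤ)
    (hs : 0 ≤ s) (hm : s ≤ m) (hm' : m ≤ N - k) :
    cls (A.F m h) ≫ cls (A.FRight s h) =
      sh 1 (cls (A.PsiPow (-1) (s - 1) k) ≫ cls (A.F (m - s + 1) h) ≫ cls (A.E (-k - 1) h) ≫
        cls (A.PsiPow (-1) (-s) k)) := by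
  rw [hA.cls_FRight h h0 hN, comp_sh, ← Category.assoc,
    hA.cls_F_comp_PsiPow h h0 hN _ _ (by lia) (by lia) (by lia) (by lia), sh_comp, sh_sh,
    Category.assoc, show m - (s - 1) = m - s + 1 by ring]
  congr 1
  ring

/-- Used after `E` and `F` have been interchanged: moving `(Ψ⁻)^{-s}` back across `F` puts `F_{m+1}`
at the end, next to the right adjoint of the remaining word. -/
lemma cls_E_comp_F_comp_PsiPow {j k : ℤ} (hj : j + 1 = k) (hN : k ≤ N) (s m : ℤ)
    (hs : 0 ≤ s) (hm : s ≤ m) (hm' : m ≤ N - k) :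
    cls (A.E (-k - 1) hj) ≫ cls (A.F (m - s + 1) hj) ≫ cls (A.PsiPow (-1) (-s) k) =
      sh s (cls (A.E (-k - 1) hj) ≫ cls (A.PsiPow (-1) (-s) j) ≫ cls (A.F (m + 1) hj)) := by
  by_cases hj0 : 0 ≤ j
  · rw [hA.cls_F_comp_PsiPow hj hj0 hN _ _ (by lia) (by lia) (by lia) (by lia), comp_sh, neg_neg,
      show m - s + 1 - -s = m + 1 by ring]
  -- If `j < 0`, no relation is available at weight `j`, but `E` lands in a zero weight.
  · rw [hA.cls_eq_zero_of_target (Or.inl (by lia)) (cls (A.E (-k - 1) hj))]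
    simp

/-- If `l_i < m ≤ N - k` for all `i`, then `(F_{l_1} ⋯ F_{l_k} 1_(0, N))^R F_m = 0`. -/
lemma cls_F_comp_FWordRight (k : ℕ) (l : Fin k → ℕ) {j : ℤ} (h : j + 1 = k) (m : ℤ)
    (hl : ∀ i, (l i : ℤ) < m) (hm : m ≤ N - k) :
    cls (A.F m h) ≫ cls (A.FWordRight k l) = 0 := by
  induction k generalizing j m with
  | zero =>
    -- Here `F_m` starts at the zero weight `-1`.
    rw [hA.cls_eq_zero_of_source (Or.inl (by push_cast at h; lia)) (cls (A.F m h)), zero_comp]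
  | succ k ih =>
    obtain rfl : j = k := by push_cast at h; lia
    have hl0 := hl 0
    push_cast at hm
    have h1 : (k : ℤ) - 1 + 1 = k := by ring
    -- The indices add up to `m - l_0 - k`, which is at least `-k+1` exactly because `l_0 < m`.
    have hEF : cls (A.F (m - l 0 + 1) h) ≫ cls (A.E (-k - 1) h) =
        cls (A.E (-k - 1) h1) ≫ cls (A.F (m - l 0 + 1) h1) :=
      (cls_eq_iff.2 (hA.E_F_mid _ _ h1 h (by lia) (by lia) (by lia) (by lia) (by lia) (by lia)
        (by lia) (by lia))).symm
    rw [ActionData.cls_FWordRight_succ, ← Category.assoc,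
      hA.cls_F_comp_FRight h (by lia) (by lia) _ _ (by lia) (by lia) (by lia),
      ← Category.assoc (cls (A.F _ _)), hEF, Category.assoc,
      hA.cls_E_comp_F_comp_PsiPow h1 (by lia) _ _ (by lia) (by lia) (by lia)]
    simp only [sh_comp, comp_sh, Category.assoc]
    -- The word loses a row and the index of `F` rises by one; the upper bound rises with it.
    rw [ih _ h1 (m + 1) (fun i => by have := hl i.succ; lia) (by lia)]
    simp

/-- If `l_i ≤ s < N - k` for all `i`, then
`(F_{l_1} ⋯ F_{l_k} 1_(0, N))^R (F_s)^R F_s` is `(F_{l_1} ⋯ F_{l_k} 1_(0, N))^R`. -/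
lemma cls_F_comp_FRight_comp_FWordRight (k : ℕ) (l : Fin k → ℕ) {k' : ℤ} (h : (k : ℤ) + 1 = k')
    (s : ℤ) (h0 : 0 ≤ s) (hl : ∀ i, (l i : ℤ) ≤ s) (hs : s < N - k) :
    cls (A.F s h) ≫ cls (A.FRight s h) ≫ cls (A.FWordRight k l) = cls (A.FWordRight k l) := by
  have h1 : (k : ℤ) - 1 + 1 = k := by ring
  -- For equal indices `m = s` the sum is `-k`, where a triangle with third term `Ψ⁻` replaces
  -- commutation. Its middle term contains `F_{s+1}` followed by the right adjoint of the word,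
  -- which vanishes.
  have tri := (hA.E_F_bot (-k - 1) 1 h1 h (by lia) (by lia) (by lia) (by lia) (by lia) (by lia)
    (by lia)).cls_comp_eq (A.PsiPow (-1) (s - 1) k) (A.PsiPow (-1) (-s) k ≫ A.FWordRight k l) (by
      have := hA.cls_E_comp_F_comp_PsiPow h1 (by lia) s s h0 le_rfl (by lia)
      rw [sub_self, zero_add] at this
      rw [cls_comp, cls_comp, Category.assoc, ← Category.assoc (cls (A.F _ _)),
        ← Category.assoc (cls (A.E _ _)), this]
      simp only [sh_comp, comp_sh, Category.assoc]
      rw [hA.cls_F_comp_FWordRight k l h1 (s + 1) (fun i => by have := hl i; lia) (by lia)]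
      simp)
  rw [cls_comp, cls_comp, ← ActionData.cls_PsiPow_one,
    hA.cls_PsiPow_add_assoc (by lia) (by lia), hA.cls_PsiPow_add_assoc (by lia) (by lia),
    -- The surviving `Ψ⁻` exactly cancels the powers `s-1` and `-s` around it.
    show s - 1 + 1 + -s = 0 by ring, ActionData.cls_PsiPow_zero, Category.id_comp] at tri
  refine Eq.trans ?_ tri.symm
  rw [← Category.assoc, hA.cls_F_comp_FRight h (by lia) (by lia) s s h0 le_rfl (by lia),
    sub_self, zero_add]
  simp only [sh_comp, Category.assoc]

/-- `(F_l 1_(0, N))^R F_l 1_(0, N)` is the identity. -/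
lemma cls_FWord_comp_FWordRight_self (k : ℕ) (l : Fin k → ℕ) (hl : Antitone l)
    (hN : ∀ i, (l i : ℤ) ≤ N - k) :
    cls (A.FWord k l) ≫ cls (A.FWordRight k l) = 𝟙 _ := by
  induction k with
  | zero => exact Category.id_comp _
  | succ k ih =>
    have h0 := hN 0
    push_cast at h0
    rw [ActionData.cls_FWord_succ, ActionData.cls_FWordRight_succ, Category.assoc,
      hA.cls_F_comp_FRight_comp_FWordRight k _ _ _ (by lia)
        (fun i => by exact_mod_cast hl (Fin.zero_le _)) (by lia)]
    exact ih _ (fun i j hij => hl (Fin.succ_le_succ_iff.2 hij))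
      (fun i => by have := hN i.succ; push_cast at this; lia)

/-- `(F_l 1_(0, N))^R F_m 1_(0, N) = 0` if `l` is lexicographically smaller than `m`. -/
lemma cls_FWord_comp_FWordRight_of_lt (k : ℕ) (l m : Fin k → ℕ) (hl : Antitone l)
    (hN : ∀ i, (m i : ℤ) ≤ N - k) (hlm : toLex l < toLex m) :
    cls (A.FWord k m) ≫ cls (A.FWordRight k l) = 0 := by
  induction k with
  | zero => exact absurd hlm (by rw [Subsingleton.elim l m]; exact lt_irrefl _)
  | succ k ih =>
    have h0 := hN 0
    rw [ActionData.cls_FWord_succ, Category.assoc]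
    -- Let `i` be the first row where the words differ. If `i = 0`, all rows of `l` are below `m_0`
    -- and the vanishing lemma applies; otherwise the equal first rows cancel.
    obtain ⟨i, hi, hi'⟩ := hlm
    simp only [Pi.toLex_apply] at hi hi'
    induction i using Fin.cases with
    | zero =>
      rw [hA.cls_F_comp_FWordRight (k + 1) l _ _ (fun j => ?_) h0, comp_zero]
      have := hl (Fin.zero_le j)
      lia
    | succ i =>
      have e := hi 0 (Fin.succ_pos i)
      push_cast at h0
      rw [ActionData.cls_FWordRight_succ, e, hA.cls_F_comp_FRight_comp_FWordRight k _ _ _ (by lia)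
        (fun i => by rw [← e]; exact_mod_cast hl (Fin.zero_le _)) (by lia)]
      exact ih _ _ (fun i j hij => hl (Fin.succ_le_succ_iff.2 hij))
        (fun i => by have := hN i.succ; push_cast at this; lia)
        ⟨i, fun j hj => hi j.succ (Fin.succ_lt_succ_iff.2 hj), hi'⟩

/-! #### Composites of words with `E` and `F` -/

/-- Each of the `k` letters that `(Ψ⁻)⁻¹` crosses has its index raised by one and contributes a
shift by one. -/
lemma cls_FWord_comp_PsiPow (k : ℕ) (l : Fin k → ℕ) (hk : (k : ℤ) ≤ N)
    (hl : ∀ i, (l i : ℤ) ≤ N - k + 1) :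
    cls (A.FWord k l) ≫ cls (A.PsiPow (-1) (-1) k) =
      sh k (cls (A.PsiPow (-1) (-1) 0) ≫ cls (A.FWord k fun i => l i + 1)) := by
  induction k with
  | zero =>
    refine Eq.trans ?_ (sh_zero _).symm
    exact (Category.id_comp _).trans (Category.comp_id _).symm
  | succ k ih =>
    have h0 := hl 0
    push_cast at h0 hk
    rw [ActionData.cls_FWord_succ, ActionData.cls_FWord_succ, Category.assoc,
      hA.cls_F_comp_PsiPow _ (by lia) (by push_cast; lia) _ _ (by lia) (by lia) (by lia) (by lia),
      comp_sh, ← Category.assoc,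
      ih _ (by lia) (fun i => by have := hl i.succ; push_cast at this; lia), sh_comp, sh_sh,
      Category.assoc]
    push_cast
    rw [sub_neg_eq_add]

/-- `E` commutes with every letter except the innermost one, which acts on weight `0`. There `F E
1_0 = 0`, so `E F_s 1_0` is `Ψ⁻[-1]` for `s = 0` and zero for `0 < s ≤ N-1`. -/
lemma cls_FWord_comp_E (k : ℕ) (l : Fin (k + 1) → ℕ) (h : (k : ℤ) + 1 = (k + 1 : ℕ))
    (hk : (k : ℤ) + 1 ≤ N) (hl : ∀ i, (l i : ℤ) ≤ N - k - 1) (hl' : Antitone l) :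
    cls (A.FWord (k + 1) l) ≫ cls (A.E 0 h) =
      if l (Fin.last k) = 0 then
        sh (-1) (cls (A.PsiPow (-1) 1 0) ≫ cls (A.FWord k fun i => l i.castSucc))
      else 0 := by
  induction k with
  | zero =>
    have h0 := hl 0
    have h1 : (-1 : ℤ) + 1 = (0 : ℕ) := by simp
    have hz : cls (A.E 0 h1) ≫ cls (A.F (l 0 : ℤ) h1) = 0 :=  by
      rw [hA.cls_eq_zero_of_target (Or.inl (by simp)) (cls (A.E 0 h1)), zero_comp]
    rw [ActionData.cls_FWord_succ]
    change (𝟙 _ ≫ cls (A.F (l 0 : ℤ) _)) ≫ _ = _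
    rw [Category.id_comp]
    split_ifs with hl0
    · replace hl0 : l 0 = 0 := hl0
      have tri := (hA.E_F_bot 0 (l 0) h1 h (by lia) (by lia) (by lia) (by lia) (by lia) (by lia)
        (by simp [hl0])).cls_eq_of_isZero₂ (cls_eq_zero_iff.1 hz)
      rw [cls_comp] at tri
      rw [eq_sh_of_sh_eq tri.symm, ActionData.cls_PsiPow_one]
      exact congr_arg (sh (-1)) (Category.comp_id _).symm
    · replace hl0 : l 0 ≠ 0 := hl0
      have e := cls_eq_iff.2 (hA.E_F_mid 0 (l 0) h1 h (by lia) (by lia) (by lia) (by lia) (by lia)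
        (by lia) (by push_cast; lia) (by push_cast at *; lia))
      rw [cls_comp, hz] at e
      exact e.symm
  | succ k ih =>
    have h0 := hl 0
    have h1 : (k : ℤ) + 1 = (k + 1 : ℕ) := by simp
    -- At positive weight even the index `0` lies in the range where `E` and `F` commute.
    have e := cls_eq_iff.2 (hA.E_F_mid 0 (l 0) h1 h (by lia) (by lia) (by lia) (by lia) (by lia)
        (by lia) (by push_cast; lia) (by push_cast at *; lia))
    rw [cls_comp, cls_comp] at e
    rw [ActionData.cls_FWord_succ, Category.assoc, ← e, ← Category.assoc,
      ih _ h1 (by push_cast at hk; lia)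
      (fun i => by have := hl i.succ; push_cast at this; lia)
      (fun i j hij => hl' (Fin.succ_le_succ_iff.2 hij)), Fin.succ_last]
    split_ifs with hl0
    · rw [sh_comp, Category.assoc]
      rfl
    · rw [zero_comp]

end IsCategoricalAction

/-! ### Glueing t-structures along a semiorthogonal family of adjunctions -/

section Glue

variable {C : Type*} [Category C] [Preadditive C] [HasZeroObject C] [HasShift C ℤ]
  [∀ n : ℤ, (shiftFunctor C n).Additive] [Pretriangulated C]
  {D : Type*} [Category D] [Preadditive D] [HasZeroObject D] [HasShift D ℤ]
  [∀ n : ℤ, (shiftFunctor D n).Additive] [Pretriangulated D]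

open Triangulated
open scoped ZeroObject

namespace TStructureGlue

lemma le_iff_shift (t : TStructure C) (n : ℤ) (X : C) : t.le n X ↔ t.le 0 (X⟦n⟧) := by
  simpa using (t.isLE_shift_iff X n n 0).symm

lemma ge_iff_shift (t : TStructure C) (n : ℤ) (X : C) : t.ge n X ↔ t.ge 0 (X⟦n⟧) := by
  simpa using (t.isGE_shift_iff X n n 0).symm

/-- Two t-structures are equal if the `≤ 0` and `≥ 0` parts of one lie in those of the other. -/
lemma tStructure_eq_of_le (s s' : TStructure C) (hle : ∀ X, s.le 0 X → s'.le 0 X)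
    (hge : ∀ X, s.ge 0 X → s'.ge 0 X) : s = s' := by
  have hle' (n : ℤ) (X : C) (h : s.IsLE X n) : s'.IsLE X n := by
    rw [← TStructure.le_iff_isLE] at h ⊢
    exact (le_iff_shift s' n X).2 (hle _ ((le_iff_shift s n X).1 h))
  have hge' (n : ℤ) (X : C) (h : s.IsGE X n) : s'.IsGE X n := by
    rw [← TStructure.ge_iff_isGE] at h ⊢
    exact (ge_iff_shift s' n X).2 (hge _ ((ge_iff_shift s n X).1 h))
  have e1 : s.le = s'.le := by
    ext n X
    rw [TStructure.le_iff_isLE, TStructure.le_iff_isLE]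
    -- The `≤ n` part is the left orthogonal of the `≥ n+1` part, so an inclusion of one half gives
    -- the reverse inclusion of the other.
    refine ⟨hle' n X, fun h => (s.isLE_iff_orthogonal n (n + 1) rfl X).2 fun Y f hY => ?_⟩
    have := hge' _ _ hY
    exact s'.zero f n (n + 1)
  have e2 : s.ge = s'.ge := by
    ext n X
    rw [TStructure.ge_iff_isGE, TStructure.ge_iff_isGE]
    refine ⟨hge' n X, fun h => (s.isGE_iff_orthogonal (n - 1) n (by lia) X).2 fun Y f hY => ?_⟩
    have := hle' _ _ hY
    exact s'.zero f (n - 1) n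
  cases s
  cases s'
  cases e1
  cases e2
  rfl

/-- The t-structure all of whose objects are `≤ n`, for all `n`. -/
def trivialTStructure : TStructure C where
  le _ := ⊤
  ge _ := IsZero
  ge_isClosedUnderIsomorphisms _ := ⟨fun e h => h.of_iso e.symm⟩
  le_shift _ _ _ _ _ _ := trivial
  ge_shift _ a _ _ _ h := (shiftFunctor C a).map_isZero h
  zero' _ _ f _ h := h.eq_of_tgt f 0
  le_zero_le _ _ := trivial
  ge_one_le _ h := h
  exists_triangle_zero_one X :=
    ⟨X, 0, trivial, isZero_zero C, 𝟙 X, 0, 0, contractible_distinguished X⟩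

variable {ι : Type*} (t : TStructure C) (F : ι → C ⥤ D) (G : ι → D ⥤ C)
  (adj : ∀ i, F i ⊣ G i)

/-- The objects which are left orthogonal to all `Z` such that all `G_i Z` are `≥ 1`, and whose
images under all `G_i` are `≤ 0`. -/
def IsAisle (X : D) : Prop :=
  (∀ i, t.IsLE ((G i).obj X) 0) ∧
    ∀ (Z : D) (_ : ∀ i, t.IsGE ((G i).obj Z) 1) (f : X ⟶ Z), f = 0

variable {t F G}

omit [HasZeroObject D] [HasShift D ℤ] [∀ n : ℤ, (shiftFunctor D n).Additive] [Pretriangulated D] in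
include adj in
lemma isAisle_obj (hle : ∀ i j X, t.le 0 X → t.le 0 ((G i).obj ((F j).obj X))) (j : ι) (X : C)
    (hX : t.le 0 X) : IsAisle t G ((F j).obj X) := by
  refine ⟨fun i => ⟨hle i j X hX⟩, fun Z hZ f => ?_⟩
  apply ((adj j).homEquiv _ _).injective
  have : t.IsLE X 0 := ⟨hX⟩
  have := hZ j
  exact (t.zero _ 0 1).trans (t.zero _ 0 1).symm

variable [∀ i, (G i).CommShift ℤ] [∀ i, (G i).IsTriangulated]

/-- Closure under extensions lets the truncation be assembled one index at a time. -/
lemma IsAisle.ext {T : Triangle D} (hT : T ∈ distTriang D) (h₁ : IsAisle t G T.obj₁)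
    (h₃ : IsAisle t G T.obj₃) : IsAisle t G T.obj₂ := by
  refine ⟨fun i => t.isLE₂ _ ((G i).map_distinguished _ hT) 0 (h₁.1 i) (h₃.1 i),
    fun Z hZ f => ?_⟩
  obtain ⟨g, rfl⟩ := Triangle.yoneda_exact₂ _ hT f (h₁.2 Z hZ _)
  rw [h₃.2 Z hZ g, comp_zero]

lemma isAisle_of_isZero {X : D} (hX : IsZero X) : IsAisle t G X :=
  ⟨fun i => t.isLE_of_isZero ((G i).map_isZero hX) 0, fun _ _ _ => hX.eq_of_src _ _⟩

variable [LinearOrder ι] [IsTriangulated D]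

-- Truncates the components one after another: each step removes `F_a (τ_{≤0} G_a B)` from the
-- current quotient `B`.
include adj in
lemma exists_triangle_finset (hunit : ∀ i, IsIso (adj i).unit)
    (hzero : ∀ i j, i < j → ∀ X, IsZero ((G i).obj ((F j).obj X)))
    (hle : ∀ i j X, t.le 0 X → t.le 0 ((G i).obj ((F j).obj X))) (s : Finset ι) (X : D) :
    ∃ (A B : D) (f : A ⟶ X) (g : X ⟶ B) (h : B ⟶ A⟦(1 : ℤ)⟧),
      Triangle.mk f g h ∈ distTriang D ∧ IsAisle t G A ∧ ∀ i ∈ s, t.IsGE ((G i).obj B) 1 := by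
  -- Indices are added in increasing order because `G_i F_a = 0` for `i < a`: the step at `a` leaves
  -- the earlier components unchanged.
  induction s using Finset.induction_on_max with
  | empty =>
    exact ⟨0, X, 0, 𝟙 X, 0, contractible_distinguished₁ X, isAisle_of_isZero (isZero_zero D),
      by simp⟩
  | insert a s ha ih =>
    obtain ⟨A, B, f, g, h, hT, hA, hB⟩ := ih
    obtain ⟨Y, Z, hY, hZ, p, q, r, hpqr⟩ := t.exists_triangle_zero_one ((G a).obj B)
    obtain ⟨B', g', h', hT'⟩ :=
      distinguished_cocone_triangle (((adj a).homEquiv Y B).symm p)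
    obtain ⟨A', f', k', hT''⟩ := distinguished_cocone_triangle₁ (g ≫ g')
    -- By the octahedral axiom, `A'` is an extension of `F_a Y` by `A`.
    have hA' : IsAisle t G A' :=
      IsAisle.ext (someOctahedron' rfl hT hT' hT'').mem hA (isAisle_obj adj hle a Y hY)
    refine ⟨A', B', f', g ≫ g', k', hT'', hA', fun i hi => ?_⟩
    have hG := (G i).map_distinguished _ hT'
    obtain rfl | hi := Finset.mem_insert.1 hi
    · have := hunit i
      have hY' : IsIso ((adj i).unit.app Y) := NatIso.isIso_app_of_isIso _ Y
      -- Since the unit is invertible, `G_a` carries the new triangle to the truncation triangle of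
      -- `G_a B`, so `G_a B'` is its `≥ 1` part.
      have e : Triangle.mk p q r ≅ (G i).mapTriangle.obj
          (Triangle.mk (((adj i).homEquiv Y B).symm p) g' h') := by
        refine isoTriangleOfIso₁₂ _ _ hpqr hG (@asIso _ _ _ _ ((adj i).unit.app Y) hY')
          (Iso.refl _) ?_
        exact (Category.comp_id p).trans (((adj i).homEquiv_unit _ _ _).symm.trans
          (Equiv.apply_symm_apply _ p)).symm
      exact ⟨(t.ge 1).prop_of_iso (Triangle.π₃.mapIso e) hZ⟩
    · have := hB i hi
      have hiso : IsIso ((G i).map g') :=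
        (Triangle.isZero₁_iff_isIso₂ _ hG).1 (hzero i a (ha i hi) Y)
      exact t.isGE_of_iso (asIso ((G i).map g')) 1

/-- The t-structure glued along a finite semiorthogonal family of fully faithful functors `F_i`
with right adjoints `G_i`: an object is `≤ 0` (resp. `≥ 0`) if all its images under the `G_i`
are. -/
def gluedTStructure [Finite ι] (hunit : ∀ i, IsIso (adj i).unit)
    (hzero : ∀ i j, i < j → ∀ X, IsZero ((G i).obj ((F j).obj X)))
    (hle : ∀ i j X, t.le 0 X → t.le 0 ((G i).obj ((F j).obj X)))
    (hcons : ∀ Y, (∀ i, IsZero ((G i).obj Y)) → IsZero Y) : TStructure D where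
  le n X := ∀ i, t.le n ((G i).obj X)
  ge n X := ∀ i, t.ge n ((G i).obj X)
  le_isClosedUnderIsomorphisms n := ⟨fun e h i => (t.le n).prop_of_iso ((G i).mapIso e) (h i)⟩
  ge_isClosedUnderIsomorphisms n := ⟨fun e h i => (t.ge n).prop_of_iso ((G i).mapIso e) (h i)⟩
  le_shift n a n' h X hX i :=
    (t.le n').prop_of_iso (((G i).commShiftIso a).app X).symm (t.le_shift n a n' h _ (hX i))
  ge_shift n a n' h X hX i :=
    (t.ge n').prop_of_iso (((G i).commShiftIso a).app X).symm (t.ge_shift n a n' h _ (hX i))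
  zero' X Y f hX hY := by
    have := Fintype.ofFinite ι
    obtain ⟨A, B, a, b, c, hT, hA, hB⟩ :=
      exists_triangle_finset adj hunit hzero hle Finset.univ X
    -- Every `G_i B` is `≥ 1` by construction and `≤ 0` as an extension of `G_i A[1]` by `G_i X`.
    -- Hence `B = 0` and `X ≅ A`, which is left orthogonal to `Y`.
    have hB0 : IsZero B := by
      refine hcons B fun i => ?_
      have h1 : t.IsGE ((G i).obj B) 1 := hB i (Finset.mem_univ i)
      have h2 : t.IsLE ((G i).obj B) 0 := by
        refine t.isLE₂ _ (rot_of_distTriang _ ((G i).map_distinguished _ hT)) 0 ⟨hX i⟩ ?_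
        have := hA.1 i
        have : t.IsLE (((G i).obj A)⟦(1 : ℤ)⟧) (-1) := t.isLE_shift _ 0 1 (-1)
        exact t.isLE_of_le (((G i).obj A)⟦(1 : ℤ)⟧) (-1) 0
      exact t.isZero _ 0 1
    have : IsIso a := (Triangle.isZero₃_iff_isIso₁ _ hT).1 hB0
    rw [← cancel_epi a, comp_zero]
    exact hA.2 Y (fun i => ⟨hY i⟩) _
  le_zero_le X hX i := t.le_zero_le _ (hX i)
  ge_one_le X hX i := t.ge_one_le _ (hX i)
  exists_triangle_zero_one X := by
    have := Fintype.ofFinite ι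
    obtain ⟨A, B, a, b, c, hT, hA, hB⟩ :=
      exists_triangle_finset adj hunit hzero hle Finset.univ X
    exact ⟨A, B, fun i => (hA.1 i).le, fun i => (hB i (Finset.mem_univ i)).ge, a, b, c, hT⟩

end TStructureGlue

end Glue

/-! ### Realization of 1-morphisms -/

section Realize

variable {B : Type u} [Bicategory.{w, v} B] (K : Pseudofunctor B Cat.{v', u'})

/-- Isomorphic 1-morphisms act by isomorphic functors. -/
def realizeIso {a b : B} {f g : a ⟶ b} (e : f ≅ g) : realize K f ≅ realize K g :=
  Cat.Hom.toNatIso (K.map₂Iso e)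

/-- A composition of 1-morphisms acts by the composition of functors. -/
def realizeComp {a b c : B} (f : a ⟶ b) (g : b ⟶ c) :
    realize K (f ≫ g) ≅ realize K f ⋙ realize K g :=
  Cat.Hom.toNatIso (K.mapComp f g)

/-- The identity 1-morphism acts by the identity functor. -/
def realizeId (a : B) : realize K (𝟙 a) ≅ 𝟭 (K.obj a) :=
  Cat.Hom.toNatIso (K.mapId a)

/-- Adjoint 1-morphisms act by adjoint functors. -/
def realizeAdj {a b : B} {f : a ⟶ b} {g : b ⟶ a} (adj : Bicategory.Adjunction f g) :
    realize K f ⊣ realize K g :=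
  Adjunction.ofCat (K.mapAdjunction adj)

variable [TriangulatedBicategory B] [TriangulatedRealization K]

/-- The action of a shift of a 1-morphism. -/
noncomputable def realizeShift {a b : B} (f : a ⟶ b) (n : ℤ) :
    realize K (f⟦n⟧) ≅ realize K f ⋙ shiftFunctor (K.obj b) n :=
  NatIso.ofComponents (fun X => ((evalAt K b X).commShiftIso n).app f) fun p =>
    (NatTrans.shift_app_comm (evalAtMap K b p) n f).symm

lemma isZero_realize_obj {a b : B} {f : a ⟶ b} (hf : IsZero f) (X : K.obj a) :
    IsZero ((realize K f).obj X) :=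
  (evalAt K b X).map_isZero hf

end Realize

/-! ### Direct sums of adjunctions -/

section DirectSum

variable {C D : Type*} [Category C] [Category D] [Preadditive D]
  {ι : Type*} [Fintype ι] {F : ι → C ⥤ D} {G : ι → D ⥤ C}

/-- The data exhibiting the functor `L` as the direct sum of the functors `F i`. -/
structure FunctorSum (L : C ⥤ D) (F : ι → C ⥤ D) where
  /-- The inclusions. -/
  inj (i : ι) : F i ⟶ L
  /-- The projections. -/
  proj (i : ι) : L ⟶ F i
  inj_proj (i : ι) (X : C) : (inj i).app X ≫ (proj i).app X = 𝟙 _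
  inj_proj_ne (i j : ι) (h : i ≠ j) (X : C) : (inj i).app X ≫ (proj j).app X = 0
  sum_proj_inj (X : C) : ∑ i, (proj i).app X ≫ (inj i).app X = 𝟙 _

namespace FunctorSum

lemma sum_comp_inj_comp_proj {L : C ⥤ D} (l : FunctorSum L F) {X : C} {Y : D}
    (f : ∀ i, Y ⟶ (F i).obj X) (i : ι) :
    (∑ j, f j ≫ (l.inj j).app X) ≫ (l.proj i).app X = f i := by
  rw [Preadditive.sum_comp, Finset.sum_eq_single i]
  · rw [Category.assoc, l.inj_proj, Category.comp_id]
  · intro j _ hj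
    rw [Category.assoc, l.inj_proj_ne j i hj, comp_zero]
  · exact fun h => absurd (Finset.mem_univ i) h

lemma inj_comp_sum_proj_comp {L : C ⥤ D} (l : FunctorSum L F) {X : C} {Y : D}
    (f : ∀ i, (F i).obj X ⟶ Y) (i : ι) :
    (l.inj i).app X ≫ (∑ j, (l.proj j).app X ≫ f j) = f i := by
  rw [Preadditive.comp_sum, Finset.sum_eq_single i]
  · rw [← Category.assoc, l.inj_proj, Category.id_comp]
  · intro j _ hj
    rw [← Category.assoc, l.inj_proj_ne i j hj.symm, zero_comp]
  · exact fun h => absurd (Finset.mem_univ i) h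

lemma eq_zero_of_inj_comp {L : C ⥤ D} (l : FunctorSum L F) {X : C} {Y : D} (f : L.obj X ⟶ Y)
    (hf : ∀ i, (l.inj i).app X ≫ f = 0) : f = 0 := by
  rw [← Category.id_comp f, ← l.sum_proj_inj X, Preadditive.sum_comp]
  exact Finset.sum_eq_zero fun i _ => by rw [Category.assoc, hf i, comp_zero]

variable [Preadditive C]

/-- A direct sum of right adjoints is a right adjoint of the direct sum. -/
def adjunction {L : C ⥤ D} {R : D ⥤ C} (l : FunctorSum L F)
    (r : FunctorSum R G) (adj : ∀ i, F i ⊣ G i) : L ⊣ R :=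
  Adjunction.mkOfHomEquiv
    { homEquiv X Y :=
        { toFun f := ∑ i, (adj i).homEquiv X Y ((l.inj i).app X ≫ f) ≫ (r.inj i).app Y
          invFun g := ∑ i, (l.proj i).app X ≫ ((adj i).homEquiv X Y).symm (g ≫ (r.proj i).app Y)
          left_inv f := by
            simp only [sum_comp_inj_comp_proj, Equiv.symm_apply_apply]
            simp only [← Category.assoc, ← Preadditive.sum_comp, l.sum_proj_inj, Category.id_comp]
          right_inv g := by
            simp only [inj_comp_sum_proj_comp, Equiv.apply_symm_apply]
            simp only [Category.assoc, ← Preadditive.comp_sum, r.sum_proj_inj, Category.comp_id] }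
      homEquiv_naturality_left_symm f g := by
        simp only [Equiv.coe_fn_symm_mk, Category.assoc (f := f), Preadditive.comp_sum,
          NatTrans.naturality_assoc]
        exact Finset.sum_congr rfl fun i _ => congr_arg _
          ((adj i).homEquiv_naturality_left_symm f _)
      homEquiv_naturality_right f g := by
        simp only [Equiv.coe_fn_mk, Preadditive.sum_comp, Category.assoc, ← NatTrans.naturality]
        simp only [← Category.assoc, Adjunction.homEquiv_naturality_right] }

end FunctorSum

end DirectSum

/-! ### Direct sums of functors and the halves of a t-structure -/

section DirectSumTStructure

namespace FunctorSum

variable {C D : Type*} [Category C] [Category D] [Preadditive C] {ι : Type*} [Fintype ι]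
  {G : ι → D ⥤ C}
  [HasZeroObject C] [HasShift C ℤ] [∀ n : ℤ, (shiftFunctor C n).Additive]
  [Pretriangulated C]

/-- The `≤ 0` part is an orthogonal, hence closed under finite direct sums and summands. -/
lemma le_obj_iff {R : D ⥤ C} (r : FunctorSum R G) (t : Triangulated.TStructure C) (Y : D) :
    t.le 0 (R.obj Y) ↔ ∀ i, t.le 0 ((G i).obj Y) := by
  simp only [Triangulated.TStructure.le_iff_isLE, t.isLE_iff_orthogonal 0 1 rfl]
  refine ⟨fun h i Z f hZ => ?_, fun h Z f hZ => ?_⟩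
  · rw [← Category.id_comp f, ← r.inj_proj i Y, Category.assoc,
      h Z ((r.proj i).app Y ≫ f) hZ, comp_zero]
  · exact r.eq_zero_of_inj_comp f fun i => h i Z _ hZ

lemma ge_obj_iff {R : D ⥤ C} (r : FunctorSum R G) (t : Triangulated.TStructure C) (Y : D) :
    t.ge 0 (R.obj Y) ↔ ∀ i, t.ge 0 ((G i).obj Y) := by
  simp only [Triangulated.TStructure.ge_iff_isGE, t.isGE_iff_orthogonal (-1) 0 rfl]
  refine ⟨fun h i Z f hZ => ?_, fun h Z f hZ => ?_⟩
  · rw [← Category.comp_id f, ← r.inj_proj i Y, ← Category.assoc,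
      h Z (f ≫ (r.inj i).app Y) hZ, zero_comp]
  · rw [← Category.comp_id f, ← r.sum_proj_inj Y, Preadditive.comp_sum]
    refine Finset.sum_eq_zero fun i _ => ?_
    rw [← Category.assoc, h i Z (f ≫ (r.proj i).app Y) hZ, zero_comp]

end FunctorSum

end DirectSumTStructure

section

variable {B : Type u} [Bicategory.{w, v} B] (K : Pseudofunctor B Cat.{v', u'})
  [TriangulatedBicategory B] [TriangulatedRealization K]

/-- A direct sum of 1-morphisms acts by the direct sum of functors. -/
noncomputable def realizeBiproduct {a b : B} {ι : Type} [Fintype ι] (f : ι → (a ⟶ b)) :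
    FunctorSum (realize K (⨁ f)) fun i => realize K (f i) where
  inj i := realizeMap K (biproduct.ι f i)
  proj i := realizeMap K (biproduct.π f i)
  inj_proj i X := by
    change (evalAt K b X).map _ ≫ (evalAt K b X).map _ = 𝟙 ((evalAt K b X).obj _)
    rw [← Functor.map_comp, biproduct.ι_π_self, CategoryTheory.Functor.map_id]
  inj_proj_ne i j h X := by
    change (evalAt K b X).map _ ≫ (evalAt K b X).map _ = _
    rw [← Functor.map_comp, biproduct.ι_π_ne f h, Functor.map_zero]
    rfl
  sum_proj_inj X := by
    change ∑ i, (evalAt K b X).map _ ≫ (evalAt K b X).map _ = 𝟙 ((evalAt K b X).obj _)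
    simp only [← Functor.map_comp, ← Functor.map_sum]
    exact (congr_arg _ (biproduct.total (f := f))).trans ((evalAt K b X).map_id _)

end

section

variable {C D : Type*} [Category C] [Category D] [HasZeroMorphisms C]

lemma isZero_rightAdjoint_obj {L : C ⥤ D} {R : D ⥤ C} (adj : L ⊣ R)
    (hL : ∀ X, IsZero (L.obj X)) (Y : D) : IsZero (R.obj Y) :=
  (IsZero.iff_id_eq_zero _).2
    (((adj.homEquiv _ _).symm.injective) ((hL _).eq_of_src _ _))

end

/-! ### Adjoints of words, and words composed with `E` and `(Ψ⁻)⁻¹` -/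

namespace IsCategoricalAction

variable {B : Type u} [Bicategory.{w, v} B] [TriangulatedBicategory B]
  {N : ℕ} {A : ActionData B} (hA : IsCategoricalAction N A)

include hA

lemma nonempty_adjunction_FRight {k l : ℤ} (h : k + 1 = l) (s : ℤ) (h0 : 0 ≤ k) (hN : k ≤ N)
    (hs : 0 ≤ s) (hs' : s ≤ N - k + 1) :
    Nonempty (Bicategory.Adjunction (A.F s h) (A.FRight s h)) :=
  hA.F_rightAdj s h h0 hN hs hs'

lemma nonempty_adjunction_FWordRight (k : ℕ) (l : Fin k → ℕ) (hk : (k : ℤ) ≤ N)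
    (hl : ∀ i, (l i : ℤ) ≤ N - k) :
    Nonempty (Bicategory.Adjunction (A.FWord k l) (A.FWordRight k l)) := by
  induction k with
  | zero => exact ⟨Bicategory.Adjunction.id _⟩
  | succ k ih =>
    have h0 := hl 0
    push_cast at h0 hk
    obtain ⟨adj⟩ := ih (fun i => l i.succ) (by lia)
      (fun i => by have := hl i.succ; push_cast at this; lia)
    obtain ⟨adj'⟩ := hA.nonempty_adjunction_FRight (Nat.cast_succ k).symm (l 0) (by lia) (by lia)
      (by lia) (by lia)
    exact ⟨adj.comp adj'⟩

/-- The composite `F_l 1_(0, N)`, `E` and `(Ψ⁻)⁻¹` is a shift of a word, or zero. -/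
lemma cls_FWord_comp_E_comp_Psi (k : ℕ) (l : Fin (k + 1) → ℕ) (h : (k : ℤ) + 1 = (k + 1 : ℕ))
    (hk : (k : ℤ) + 1 ≤ N) (hl : ∀ i, (l i : ℤ) ≤ N - k - 1) (hl' : Antitone l) :
    cls (A.FWord (k + 1) l) ≫ cls (A.E 0 h) ≫ cls (A.Psi (-1) (-1) k) =
      if l (Fin.last k) = 0 then sh (k - 1) (cls (A.FWord k fun i => l i.castSucc + 1)) else 0 := by
  rw [← Category.assoc, hA.cls_FWord_comp_E k l h hk hl hl']
  split_ifs with hl0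
  · rw [← ActionData.cls_PsiPow_neg_one, sh_comp, Category.assoc,
      hA.cls_FWord_comp_PsiPow k _ (by lia) (fun i => by have := hl i.castSucc; lia), comp_sh,
      sh_sh, hA.cls_PsiPow_add_assoc le_rfl (by lia), add_neg_cancel, ActionData.cls_PsiPow_zero,
      Category.id_comp]
    rfl
  · rw [zero_comp]

end IsCategoricalAction

/-! ### Young diagrams in a box and their lexicographic order -/

namespace BoxPartition

variable {a b : ℕ}

lemma row_injective : Function.Injective (row : BoxPartition a b → Fin b → ℕ) := fun _ _ h =>
  Subtype.ext (funext fun i => Fin.ext (congr_fun h i))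

lemma antitone_row (l : BoxPartition a b) : Antitone l.row := fun _ _ h => l.2 h

lemma row_le (l : BoxPartition a b) (i : Fin b) : l.row i ≤ a := Nat.le_of_lt_succ (l.1 i).2

lemma exists_row_eq (l : Fin b → ℕ) (hl : Antitone l) (h : ∀ i, l i ≤ a) :
    ∃ l' : BoxPartition a b, l'.row = l :=
  ⟨⟨fun i => ⟨l i, Nat.lt_succ_of_le (h i)⟩, fun _ _ hij => hl hij⟩, rfl⟩

/-- Young diagrams are ordered lexicographically. -/
noncomputable instance : LinearOrder (BoxPartition a b) :=
  LinearOrder.lift' (fun l => toLex l.row) (toLex.injective.comp row_injective)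

end BoxPartition

/-! ### The glued t-structures and exactness of the two families of functors -/

section Action

variable {B : Type u} [Bicategory.{w, v} B] [TriangulatedBicategory B]
  (K : Pseudofunctor B Cat.{v', u'})

/-- 1-morphisms with the same isomorphism class act by isomorphic functors. -/
noncomputable def realizeIsoOfCls {a b : B} {f g : a ⟶ b} (h : cls f = cls g) :
    realize K f ≅ realize K g :=
  realizeIso K (cls_eq_iff.1 h).some

namespace IsCategoricalAction

variable {N : ℕ} {A : ActionData B}

/-- `X` satisfies `P` after applying any `(F_l 1_(0, N))^R`, for `l` in `P(N - k, k)`. -/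
def WordProperty (A : ActionData B) (N : ℕ) (P : ObjectProperty (K.obj (A.wt 0))) (k : ℕ)
    (X : K.obj (A.wt k)) : Prop :=
  ∀ l : Fin k → ℕ, Antitone l → (∀ i, (l i : ℤ) ≤ N - k) →
    P ((realize K (A.FWordRight k l)).obj X)

/-- Sequences of naturals make adding or deleting a row easy, while gluing needs a finite ordered
index type; this passes between the two. -/
lemma wordProperty_iff_forall_box (P : ObjectProperty (K.obj (A.wt 0))) (k : ℕ) (hk : k ≤ N)
    (X : K.obj (A.wt k)) :
    WordProperty K A N P k X ↔
      ∀ l : BoxPartition (N - k) k, P ((realize K (A.FWordRight k l.row)).obj X) := by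
  refine ⟨fun h l => h l.row l.antitone_row fun i => ?_, fun h l hl hlN => ?_⟩
  · have := l.row_le i
    lia
  · obtain ⟨l', rfl⟩ := BoxPartition.exists_row_eq (a := N - k) l hl
      (fun i => by have := hlN i; lia)
    exact h l'

lemma wordProperty_zero_iff (P : ObjectProperty (K.obj (A.wt 0))) [P.IsClosedUnderIsomorphisms]
    (X : K.obj (A.wt 0)) : WordProperty K A N P 0 X ↔ P X := by
  have e : (realize K (𝟙 (A.wt 0))).obj X ≅ X := (realizeId K (A.wt 0)).app X
  refine ⟨fun h => P.prop_of_iso e (h Fin.elim0 (fun i => i.elim0) fun i => i.elim0),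
    fun h l _ _ => P.prop_of_iso e.symm h⟩

variable [TriangulatedRealization K] (hA : IsCategoricalAction N A)

include hA

/-- The right adjoint of `F_{N-k-1} 1_(k, N-k)` preserves the objects all of whose images under
the functors `(F_l 1_(0, N))^R` satisfy `P`. -/
lemma WordProperty.realize_FRight {P : ObjectProperty (K.obj (A.wt 0))}
    [P.IsClosedUnderIsomorphisms] (hP : ∀ X, IsZero X → P X) (k : ℕ)
    (h : (k : ℤ) + 1 = (k + 1 : ℕ)) (hk : k + 1 ≤ N) (X : K.obj (A.wt (k + 1 : ℕ)))
    (hX : WordProperty K A N P (k + 1) X) :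
    WordProperty K A N P k ((realize K (A.FRight (N - k - 1) h)).obj X) := by
  intro l hl hlN
  by_cases hl0 : ∀ i, (l i : ℤ) ≤ N - k - 1
  -- If all rows are at most `N-k-1`, this row can be put in front, giving a diagram in the box for
  -- `k+1`.
  · have key := hX (Fin.cons (N - k - 1) l) (fun i j hij => ?_) (fun i => ?_)
    · have e : cls (A.FWordRight (k + 1) (Fin.cons (N - k - 1) l)) =
          cls (A.FRight (N - k - 1) h ≫ A.FWordRight k l) := by
        rw [ActionData.cls_FWordRight_succ, cls_comp]
        simp only [Fin.cons_zero, Fin.cons_succ]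
        rw [show ((N - k - 1 : ℕ) : ℤ) = N - k - 1 by lia]
      exact P.prop_of_iso ((realizeIsoOfCls K e ≪≫ realizeComp K _ _).app X) key
    · induction i using Fin.cases with
      | zero =>
        induction j using Fin.cases with
        | zero => exact le_rfl
        | succ j =>
          have := hl0 j
          simp only [Fin.cons_zero, Fin.cons_succ]
          lia
      | succ i =>
        induction j using Fin.cases with
        | zero => exact absurd hij (by simp)
        | succ j => exact hl (Fin.succ_le_succ_iff.1 hij)
    · induction i using Fin.cases with
      | zero =>
        simp only [Fin.cons_zero]
        push_cast
        lia
      | succ i =>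
        have := hl0 i
        simp only [Fin.cons_succ]
        push_cast
        lia
  -- Otherwise the first row is `N-k`, and `F_{N-k-1} F_{N-k} = 0` makes the left adjoint of the
  -- composite vanish.
  · apply hP
    push Not at hl0
    obtain ⟨i, hi⟩ := hl0
    obtain ⟨adj₁⟩ := hA.nonempty_adjunction_FWordRight k l (by lia) hlN
    obtain ⟨adj₂⟩ := hA.nonempty_adjunction_FRight h (N - k - 1) (by lia) (by lia) (by lia)
      (by lia)
    refine isZero_rightAdjoint_obj ((realizeAdj K adj₁).comp (realizeAdj K adj₂)) (fun Y => ?_) X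
    refine (isZero_realize_obj K (f := A.FWord k l ≫ A.F (N - k - 1) h) ?_ Y).of_iso
      ((realizeComp K _ _).symm.app Y)
    cases k with
    | zero => exact i.elim0
    | succ k =>
      have h0 := hlN 0
      have h0' := hl (Fin.zero_le i)
      rw [← cls_eq_zero_iff, cls_comp, ActionData.cls_FWord_succ, Category.assoc]
      have hz := cls_eq_zero_iff.2 (hA.F_F_eq (N - (k + 1 : ℕ) - 1) (Nat.cast_succ k).symm h
        (by lia) (by lia) (by push_cast at *; lia) (by push_cast at *; lia))
      rw [cls_comp] at hz
      rw [show (l 0 : ℤ) = N - (k + 1 : ℕ) - 1 + 1 by push_cast at *; lia, hz, comp_zero]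

/-- The functor `(E 1_(k+1, N-k-1))^R Ψ⁻ [k-1]` preserves the objects all of whose images under
the functors `(F_l 1_(0, N))^R` satisfy `P`. -/
lemma WordProperty.realize_E_rightAdjoint {P : ObjectProperty (K.obj (A.wt 0))}
    [P.IsClosedUnderIsomorphisms] (hP : ∀ X, IsZero X → P X) (k : ℕ)
    (h : (k : ℤ) + 1 = (k + 1 : ℕ)) (hk : k + 1 ≤ N)
    {G : K.obj (A.wt k) ⥤ K.obj (A.wt (k + 1 : ℕ))} (adj : realize K (A.E 0 h) ⊣ G)
    (X : K.obj (A.wt k)) (hX : WordProperty K A N P k X) (m : ℤ) (hm : m = k - 1) :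
    WordProperty K A N P (k + 1) ((realize K (A.Psi (-1) 1 k) ⋙ G ⋙
      shiftFunctor (K.obj (A.wt (k + 1 : ℕ))) m).obj X) := by
  intro l hl hlN
  obtain ⟨adj₁⟩ := hA.nonempty_adjunction_FWordRight (k + 1) l (by lia) hlN
  let adj₂ : shiftFunctor (K.obj (A.wt (k + 1 : ℕ))) (-m) ⊣ shiftFunctor _ m :=
    (shiftEquiv' (K.obj (A.wt (k + 1 : ℕ))) (-m) m (neg_add_cancel m)).toAdjunction
  have i₁ : cls (A.Psi (-1) (-1) k ≫ A.Psi (-1) 1 k) = cls (𝟙 (A.wt k)) := by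
    have := cls_eq_iff.2 (hA.Psi_inv (-1) (-1) k (by lia) (by lia))
    rwa [neg_neg] at this
  have i₂ : cls (A.Psi (-1) 1 k ≫ A.Psi (-1) (-1) k) = cls (𝟙 (A.wt k)) :=
    cls_eq_iff.2 (hA.Psi_inv (-1) 1 k (by lia) (by lia))
  let adj₃ : realize K (A.Psi (-1) (-1) k) ⊣ realize K (A.Psi (-1) 1 k) :=
    (CategoryTheory.Equivalence.mk (realize K (A.Psi (-1) (-1) k)) (realize K (A.Psi (-1) 1 k))
      ((realizeId K _).symm ≪≫ realizeIsoOfCls K i₁.symm ≪≫ realizeComp K _ _)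
      ((realizeComp K _ _).symm ≪≫ realizeIsoOfCls K i₂ ≪≫ realizeId K _)).toAdjunction
  -- The composite is identified through its left adjoint: `F_l`, then `[-m]`, `E` and `(Ψ⁻)⁻¹`,
  -- which is a single word or zero.
  let adj₄ := (realizeAdj K adj₁).comp (adj₂.comp (adj.comp adj₃))
  let e : realize K (A.FWord (k + 1) l) ⋙ shiftFunctor _ (-m) ⋙ realize K (A.E 0 h) ⋙
      realize K (A.Psi (-1) (-1) k) ≅
        realize K ((A.FWord (k + 1) l)⟦-m⟧ ≫ A.E 0 h ≫ A.Psi (-1) (-1) k) :=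
    (Functor.associator _ _ _).symm ≪≫
      Functor.isoWhiskerRight (realizeShift K _ _).symm _ ≪≫
      Functor.isoWhiskerLeft _ (realizeComp K _ _).symm ≪≫ (realizeComp K _ _).symm
  have key := hA.cls_FWord_comp_E_comp_Psi k l h (by lia)
    (fun i => by have := hlN i; push_cast at this; lia) hl
  split_ifs at key with hl0
  · have hlN' (i : Fin k) : ((l i.castSucc + 1 : ℕ) : ℤ) ≤ N - k := by
      have := hlN i.castSucc
      push_cast at *
      lia
    obtain ⟨adj₅⟩ := hA.nonempty_adjunction_FWordRight k _ (by lia) hlN'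
    have e' : cls ((A.FWord (k + 1) l)⟦-m⟧ ≫ A.E 0 h ≫ A.Psi (-1) (-1) k) =
        cls (A.FWord k fun i => l i.castSucc + 1) := by
      rw [cls_comp, cls_shift, sh_comp, cls_comp, key, sh_sh, hm, add_neg_cancel, sh_zero]
    let e₂ := ((adj₄.ofNatIsoLeft (e ≪≫ realizeIsoOfCls K e')).rightAdjointUniq
      (realizeAdj K adj₅)).symm.app X
    refine P.prop_of_iso e₂ (hX _ (fun i j hij => ?_) hlN')
    exact Nat.succ_le_succ (hl (Fin.castSucc_le_castSucc_iff.2 hij))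
  · refine hP _ (isZero_rightAdjoint_obj adj₄ (fun Y => ?_) X)
    refine (isZero_realize_obj K (cls_eq_zero_iff.1 ?_) Y).of_iso (e.app Y)
    rw [cls_comp, cls_shift, sh_comp, cls_comp, key, sh_zero_hom]

/-- If the image of `φ_k` weakly generates, then the functors `(F_l 1_(0, N))^R` detect zero
objects. -/
lemma isZero_of_isZero_realize_FWordRight (k : ℕ) (hk : k ≤ N)
    (hgen : WeaklyGenerates fun X : K.obj (A.wt 0) => (realize K (A.phi N k)).obj X)
    (Y : K.obj (A.wt k))
    (hY : ∀ l : BoxPartition (N - k) k, IsZero ((realize K (A.FWordRight k l.row)).obj Y)) :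
    IsZero Y := by
  have := Fintype.ofFinite (BoxPartition (N - k) k)
  refine hgen Y fun X n f => ?_
  have hz (X : K.obj (A.wt 0)) (f : (realize K (A.phi N k)).obj X ⟶ Y) : f = 0 := by
    refine (realizeBiproduct K fun l : BoxPartition (N - k) k =>
      A.FWord k l.row).eq_zero_of_inj_comp f fun l => ?_
    obtain ⟨adj⟩ := hA.nonempty_adjunction_FWordRight k l.row (by lia)
      (fun i => by have := l.row_le i; lia)
    exact ((realizeAdj K adj).homEquiv _ _).injective ((hY l).eq_of_tgt _ _)
  rw [← cancel_epi (((realize K (A.phi N k)).commShiftIso n).hom.app X), comp_zero]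
  exact hz _ _

/-- The t-structure pulled back along all the functors `(F_l 1_(0, N))^R`. -/
lemma exists_tStructure (k : ℕ) (hk : k ≤ N)
    (hgen : WeaklyGenerates fun X : K.obj (A.wt 0) => (realize K (A.phi N k)).obj X)
    (t : Triangulated.TStructure (K.obj (A.wt 0)))
    (hexact : ∀ l l' : BoxPartition (N - k) k,
      ∃ G : K.obj (A.wt k) ⥤ K.obj (A.wt 0), Nonempty (realize K (A.FWord k l.row) ⊣ G) ∧
        TExact t t (realize K (A.FWord k l'.row) ⋙ G)) :
    ∃ T : Triangulated.TStructure (K.obj (A.wt k)),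
      (∀ X, T.le 0 X ↔ WordProperty K A N (t.le 0) k X) ∧
      (∀ X, T.ge 0 X ↔ WordProperty K A N (t.ge 0) k X) := by
  have hN (l : BoxPartition (N - k) k) (i : Fin k) : (l.row i : ℤ) ≤ N - k := by
    have := l.row_le i
    lia
  let adj (l : BoxPartition (N - k) k) :=
    realizeAdj K (hA.nonempty_adjunction_FWordRight k l.row (by lia) (hN l)).some
  refine ⟨TStructureGlue.gluedTStructure (t := t) adj (fun l => ?_) (fun l m hlm X => ?_)
    (fun l m X hX => ?_) (fun Y hY => hA.isZero_of_isZero_realize_FWordRight K k hk hgen Y hY),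
    fun X => (wordProperty_iff_forall_box K _ k hk X).symm,
    fun X => (wordProperty_iff_forall_box K _ k hk X).symm⟩
  -- Any isomorphism `G F ≅ 1` forces the unit to be invertible, so knowing the isomorphism class of
  -- the 1-morphism is enough.
  · exact (adj l).isIso_unit_of_iso ((realizeComp K _ _).symm ≪≫
      realizeIsoOfCls K (hA.cls_FWord_comp_FWordRight_self k l.row l.antitone_row (hN l)) ≪≫
      realizeId K _)
  · exact (isZero_realize_obj K (cls_eq_zero_iff.1 (hA.cls_FWord_comp_FWordRight_of_lt k l.row
      m.row l.antitone_row (hN m) hlm)) X).of_iso ((realizeComp K _ _).symm.app X)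
  · obtain ⟨G, ⟨adj'⟩, hG⟩ := hexact l m
    exact (t.le 0).prop_of_iso ((adj'.rightAdjointUniq (adj l)).app _) (hG.1 X hX)

/-- `(φ_k)^R` is the direct sum of the functors `(F_l 1_(0, N))^R`. -/
lemma exists_phi_rightAdjoint (k : ℕ) (hk : k ≤ N)
    (t : Triangulated.TStructure (K.obj (A.wt 0))) :
    ∃ G : K.obj (A.wt k) ⥤ K.obj (A.wt 0), Nonempty (realize K (A.phi N k) ⊣ G) ∧
      (∀ X, t.le 0 (G.obj X) ↔ WordProperty K A N (t.le 0) k X) ∧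
      (∀ X, t.ge 0 (G.obj X) ↔ WordProperty K A N (t.ge 0) k X) := by
  have := Fintype.ofFinite (BoxPartition (N - k) k)
  let R := realizeBiproduct K fun l : BoxPartition (N - k) k => A.FWordRight k l.row
  let S := realizeBiproduct K fun l : BoxPartition (N - k) k => A.FWord k l.row
  refine ⟨_, ⟨S.adjunction R fun l => realizeAdj K (hA.nonempty_adjunction_FWordRight k l.row
    (by lia) (fun i => by have := l.row_le i; lia)).some⟩, fun X => ?_, fun X => ?_⟩
  · rw [R.le_obj_iff, wordProperty_iff_forall_box K _ k hk]
  · rw [R.ge_obj_iff, wordProperty_iff_forall_box K _ k hk]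

end IsCategoricalAction

end Action

theorem theorem7 {B : Type u} [Bicategory.{w, v} B] [TriangulatedBicategory B]
    (K : Pseudofunctor B Cat.{v', u'}) [TriangulatedRealization K]
    (N : ℕ) (A : ActionData B) (hA : IsCategoricalAction N A)
    -- the image of `φ_k` weakly generates `K(k, N - k)`
    (hgen : ∀ k : ℕ, 1 ≤ k → k ≤ N →
      WeaklyGenerates fun X : K.obj (A.wt 0) => (realize K (A.phi N k)).obj X)
    -- the t-structure on the highest weight category `K(0, N)`
    (t : Triangulated.TStructure (K.obj (A.wt 0)))
    -- `(F_l)^R F_l'` is t-exact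
    (hexact : ∀ k : ℕ, 1 ≤ k → k ≤ N → ∀ l l' : BoxPartition (N - k) k,
      ∃ G : K.obj (A.wt k) ⥤ K.obj (A.wt 0), Nonempty (realize K (A.FWord k l.row) ⊣ G) ∧
        TExact t t (realize K (A.FWord k l'.row) ⋙ G)) :
    ∃ T : ∀ k : ℤ, Triangulated.TStructure (K.obj (A.wt k)),
      T 0 = t ∧
      -- `T k` is pulled back from `t` along `(φ_k)^R`
      (∀ k : ℕ, 1 ≤ k → k ≤ N →
        ∃ G : K.obj (A.wt k) ⥤ K.obj (A.wt 0), Nonempty (realize K (A.phi N k) ⊣ G) ∧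
          (∀ X, (T k).le 0 X ↔ t.le 0 (G.obj X)) ∧ (∀ X, (T k).ge 0 X ↔ t.ge 0 (G.obj X))) ∧
      -- `(F_{N-k-1} 1_(k, N-k))^R` is t-exact
      (∀ (k l : ℤ) (h : k + 1 = l), 0 ≤ k → l ≤ N →
        ∃ G : K.obj (A.wt l) ⥤ K.obj (A.wt k), Nonempty (realize K (A.F (N - k - 1) h) ⊣ G) ∧
          TExact (T l) (T k) G) ∧
      -- `(E 1_(k, N-k))^R Ψ⁻ [k-2]` is t-exact
      (∀ (j k : ℤ) (h : j + 1 = k), 1 ≤ k → k ≤ N →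
        ∃ G : K.obj (A.wt j) ⥤ K.obj (A.wt k), Nonempty (realize K (A.E 0 h) ⊣ G) ∧
          TExact (T j) (T k)
            (realize K (A.Psi (-1) 1 j) ⋙ G ⋙ shiftFunctor (K.obj (A.wt k)) (k - 2))) ∧
      -- `T` is the unique extension of `t` for which all `(φ_k)^R` are t-exact
      (∀ T' : ∀ k : ℤ, Triangulated.TStructure (K.obj (A.wt k)),
        T' 0 = t →
        (∀ k : ℕ, 1 ≤ k → k ≤ N →
          ∃ G : K.obj (A.wt k) ⥤ K.obj (A.wt 0), Nonempty (realize K (A.phi N k) ⊣ G) ∧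
            TExact (T' k) t G) →
        ∀ k : ℤ, 0 ≤ k → k ≤ N → T' k = T k) := by
  have hN : ∀ k : ℕ, ∃ T : Triangulated.TStructure (K.obj (A.wt (k + 1 : ℕ))), k + 1 ≤ N →
      (∀ X, T.le 0 X ↔ IsCategoricalAction.WordProperty K A N (t.le 0) (k + 1) X) ∧
      (∀ X, T.ge 0 X ↔ IsCategoricalAction.WordProperty K A N (t.ge 0) (k + 1) X) := by
    intro k
    by_cases hk : k + 1 ≤ N
    · obtain ⟨T, hT⟩ := hA.exists_tStructure K (k + 1) hk (hgen (k + 1) (by lia) hk) t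
        (hexact (k + 1) (by lia) hk)
      exact ⟨T, fun _ => hT⟩
    · exact ⟨TStructureGlue.trivialTStructure, fun h => absurd h hk⟩
  choose S hS using hN
  let T : ∀ k : ℤ, Triangulated.TStructure (K.obj (A.wt k))
    | Int.ofNat 0 => t
    | Int.ofNat (k + 1) => S k
    | Int.negSucc _ => TStructureGlue.trivialTStructure
  have hT (k : ℕ) (hk : k ≤ N) :
      (∀ X, (T k).le 0 X ↔ IsCategoricalAction.WordProperty K A N (t.le 0) k X) ∧
      (∀ X, (T k).ge 0 X ↔ IsCategoricalAction.WordProperty K A N (t.ge 0) k X) := by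
    cases k with
    | zero =>
      exact ⟨fun X => (IsCategoricalAction.wordProperty_zero_iff K (t.le 0) X).symm,
        fun X => (IsCategoricalAction.wordProperty_zero_iff K (t.ge 0) X).symm⟩
    | succ k => exact hS k hk
  have hle0 (X : K.obj (A.wt 0)) (hX : IsZero X) : t.le 0 X := (t.isLE_of_isZero hX 0).le
  have hge0 (X : K.obj (A.wt 0)) (hX : IsZero X) : t.ge 0 X := (t.isGE_of_isZero hX 0).ge
  refine ⟨T, rfl, fun k _ hk => ?_, fun k l h hk hl => ?_, fun j k h hk hkN => ?_,
    fun T' hT' hφ k hk hkN => ?_⟩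
  · obtain ⟨G, adj, hG, hG'⟩ := hA.exists_phi_rightAdjoint K k hk t
    exact ⟨G, adj, fun X => ((hT k hk).1 X).trans (hG X).symm,
      fun X => ((hT k hk).2 X).trans (hG' X).symm⟩
  · lift k to ℕ using hk
    lift l to ℕ using by lia
    obtain rfl : l = k + 1 := by lia
    obtain ⟨adj⟩ := hA.nonempty_adjunction_FRight h (N - k - 1) (by lia) (by lia) (by lia)
      (by lia)
    have hk := hT k (by lia)
    have hk' := hT (k + 1) (by lia)
    exact ⟨_, ⟨realizeAdj K adj⟩,
      fun X hX => (hk.1 _).2 (IsCategoricalAction.WordProperty.realize_FRight K hA hle0 k h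
        (by lia) X ((hk'.1 X).1 hX)),
      fun X hX => (hk.2 _).2 (IsCategoricalAction.WordProperty.realize_FRight K hA hge0 k h
        (by lia) X ((hk'.2 X).1 hX))⟩
  · lift j to ℕ using by lia
    lift k to ℕ using by lia
    obtain rfl : k = j + 1 := by lia
    obtain ⟨adj⟩ := hA.E_rightAdj 0 h (by lia) hkN (by lia) le_rfl
    have hj := hT j (by lia)
    have hj' := hT (j + 1) (by lia)
    have hm : ((j + 1 : ℕ) : ℤ) - 2 = j - 1 := by push_cast; ring
    exact ⟨_, ⟨realizeAdj K adj⟩,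
      fun X hX => (hj'.1 _).2 (IsCategoricalAction.WordProperty.realize_E_rightAdjoint K hA hle0 j
        h (by lia) (realizeAdj K adj) X ((hj.1 X).1 hX) _ hm),
      fun X hX => (hj'.2 _).2 (IsCategoricalAction.WordProperty.realize_E_rightAdjoint K hA hge0 j
        h (by lia) (realizeAdj K adj) X ((hj.2 X).1 hX) _ hm)⟩
  · lift k to ℕ using hk
    obtain rfl | hk := Nat.eq_zero_or_pos k
    · exact hT'
    · obtain ⟨G, ⟨adj⟩, hG⟩ := hφ k hk (by lia)
      obtain ⟨G', ⟨adj'⟩, hle, hge⟩ := hA.exists_phi_rightAdjoint K k (by lia) t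
      let e := adj.rightAdjointUniq adj'
      -- Exactness of `(φ_k)^R` gives only that both halves of `T'` lie in those of `T`, which
      -- already forces equality.
      exact TStructureGlue.tStructure_eq_of_le _ _
        (fun X hX => ((hT k (by lia)).1 X).2 ((hle X).1
          ((t.le 0).prop_of_iso (e.app X) (hG.1 X hX))))
        (fun X hX => ((hT k (by lia)).2 X).2 ((hge X).1
          ((t.ge 0).prop_of_iso (e.app X) (hG.2 X hX))))
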